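/- **Theorem.** The model of computation is a word RAM with words of $w=\Theta(\log N)$ bits, in which each of the following takes one step: loading a constant, the usual arithmetic ($+,-,\times$, integer division and remainder), bitwise and shift operations on words, comparison of two registers, reading a word of the (read-only) memory that holds the data structure, and each operation ($\oplus$, inverse, neutral element) of a given finite abelian group $(G,\oplus,{}^{-1},0)$ with $N=|G|$ elements, where group elements are represented by the numbers $0,\dots,N-1$ under an arbitrary fixed bijection. A program uses a constant number of working registers. Let $\kappa\ge 0$ be a fixed integer. Let $r\ge 2$ and $N$ satisfy $r\le N^{\kappa}$ (that is, $\log r=O(\log N)$), and let an $r\times r$ grid store $r$ points (several points may share a row, a column or a cell) with associated values in an abelian group $G$ of $N$ elements. Then for every $\varepsilon>0$ there is a data structure of $$O\bigl(\max(1,1/\varepsilon)\; r\log_2 N\bigr)$$ bits from which, for every rectangle $[x_1,x_2]\times[y_1,y_2]$ of the grid, the $\oplus$-sum of the values of the points in the rectangle is computed in time $$O\bigl(\max(1,1/\varepsilon)\,(\log_2 r)^{2+\varepsilon}\bigr).$$ The query program, the constant relating $w$ to $\log N$, and the constants hidden in the $O(\cdot)$ depend only on $\kappa$; in particular they do not depend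 on $\varepsilon$, $r$, $N$, $G$, the points or their values. (For $\varepsilon\le 1$ the factor $\max(1,1/\varepsilon)$ is $1/\varepsilon$.) -/

import Mathlib

/-! A word RAM with `w`-bit words, unit-cost steps, a read-only memory that holds the data
structure, finitely many working registers per program, and the operations of a finite group `G`
available as unit-cost instructions. An element of `G` is handled through its code, a number
below `N = |G|`. -/
namespace WordRAM

/-- Binary operations on words (arithmetic is modulo `2 ^ w`; division by zero gives zero). -/
inductive BinOp
  | add | sub | mul | div | mod | and | or | xor | shl | shr

def BinOp.eval {w : ℕ} : BinOp → BitVec w → BitVec w → BitVec w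
  | .add, a, b => a + b
  | .sub, a, b => a - b
  | .mul, a, b => a * b
  | .div, a, b => BitVec.ofNat w (a.toNat / b.toNat)
  | .mod, a, b => BitVec.ofNat w (a.toNat % b.toNat)
  | .and, a, b => a &&& b
  | .or, a, b => a ||| b
  | .xor, a, b => a ^^^ b
  | .shl, a, b => a <<< b.toNat
  | .shr, a, b => a >>> b.toNat

/-- Instructions; `d`, `a`, `b` are register names and `d` is the destination. -/
inductive Instr
  /-- load the constant `k` -/
  | const (d k : ℕ)
  /-- word operation -/
  | bin (o : BinOp) (d a b : ℕ)
  /-- read the memory word whose address is in register `a` -/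
  | load (d a : ℕ)
  /-- neutral element of the group -/
  | gzero (d : ℕ)
  /-- group operation -/
  | gadd (d a b : ℕ)
  /-- group inverse -/
  | gneg (d a : ℕ)

/-- Tests that compare two registers. -/
inductive Test
  | lt (a b : ℕ)
  | eq (a b : ℕ)

/-- Programs. They mention neither the word length nor the group nor the data. -/
inductive Prog
  | skip
  | instr (i : Instr)
  | seq (p q : Prog)
  | ite (b : Test) (p q : Prog)
  | loop (b : Test) (p : Prog)

/-- Contents of the registers. -/
abbrev Regs (w : ℕ) := ℕ → BitVec w

def Test.eval {w : ℕ} (s : Regs w) : Test → Bool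
  | .lt a b => decide ((s a).toNat < (s b).toNat)
  | .eq a b => decide (s a = s b)

section Semantics

variable {w N : ℕ} {G : Type*} [AddCommGroup G]

/-- The word that holds the code of a group element. -/
def encode (w : ℕ) (code : G ≃ Fin N) (g : G) : BitVec w :=
  BitVec.ofNat w (code g : ℕ)

/-- The group element whose code a word holds (`0` if the word is not a code). -/
def decode (code : G ≃ Fin N) (a : BitVec w) : G :=
  if h : a.toNat < N then code.symm ⟨a.toNat, h⟩ else 0

/-- The word that an instruction writes. Reading past the end of the memory gives `0`. -/
def Instr.value (mem : List (BitVec w)) (code : G ≃ Fin N) (s : Regs w) : Instr → BitVec w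
  | .const _ k => BitVec.ofNat w k
  | .bin o _ a b => o.eval (s a) (s b)
  | .load _ a => mem.getD (s a).toNat 0
  | .gzero _ => encode w code 0
  | .gadd _ a b => encode w code (decode code (s a) + decode code (s b))
  | .gneg _ a => encode w code (-decode code (s a))

/-- The register that an instruction writes. -/
def Instr.dest : Instr → ℕ
  | .const d _ => d
  | .bin _ d _ _ => d
  | .load d _ => d
  | .gzero d => d
  | .gadd d _ _ => d
  | .gneg d _ => d

/-- `Exec mem code p s s' t`: with memory `mem`, the program `p`, started with register contents
`s`, halts with register contents `s'` after exactly `t` steps. Each instruction and each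
evaluation of a test is one step. -/
inductive Exec (mem : List (BitVec w)) (code : G ≃ Fin N) :
    Prog → Regs w → Regs w → ℕ → Prop
  | skip (s : Regs w) : Exec mem code .skip s s 1
  | instr (i : Instr) (s : Regs w) :
      Exec mem code (.instr i) s (Function.update s i.dest (i.value mem code s)) 1
  | seq {p q : Prog} {s s' s'' : Regs w} {t t' : ℕ} :
      Exec mem code p s s' t → Exec mem code q s' s'' t' →
      Exec mem code (.seq p q) s s'' (t + t')
  | ite_true {b : Test} {p q : Prog} {s s' : Regs w} {t : ℕ} :
      b.eval s = true → Exec mem code p s s' t → Exec mem code (.ite b p q) s s' (t + 1)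
  | ite_false {b : Test} {p q : Prog} {s s' : Regs w} {t : ℕ} :
      b.eval s = false → Exec mem code q s s' t → Exec mem code (.ite b p q) s s' (t + 1)
  | loop_true {b : Test} {p : Prog} {s s' s'' : Regs w} {t t' : ℕ} :
      b.eval s = true → Exec mem code p s s' t → Exec mem code (.loop b p) s' s'' t' →
      Exec mem code (.loop b p) s s'' (t + t' + 1)
  | loop_false {b : Test} {p : Prog} {s : Regs w} :
      b.eval s = false → Exec mem code (.loop b p) s s 1

/-- The machine is deterministic: result and number of steps are determined by the start. -/
theorem Exec.deterministic {mem : List (BitVec w)} {code : G ≃ Fin N} {p : Prog}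
    {s s₁ s₂ : Regs w} {t₁ t₂ : ℕ} (h₁ : Exec mem code p s s₁ t₁)
    (h₂ : Exec mem code p s s₂ t₂) : s₁ = s₂ ∧ t₁ = t₂ := by
  induction h₁ generalizing s₂ t₂ with
  | skip => cases h₂; exact ⟨rfl, rfl⟩
  | instr => cases h₂; exact ⟨rfl, rfl⟩
  | seq _ _ ih ih' =>
    cases h₂ with
    | seq k k' =>
      obtain ⟨rfl, rfl⟩ := ih k
      obtain ⟨rfl, rfl⟩ := ih' k'
      exact ⟨rfl, rfl⟩
  | ite_true hb _ ih =>
    cases h₂ with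
    | ite_true _ k => obtain ⟨rfl, rfl⟩ := ih k; exact ⟨rfl, rfl⟩
    | ite_false hb' _ => simp [hb] at hb'
  | ite_false hb _ ih =>
    cases h₂ with
    | ite_true hb' _ => simp [hb] at hb'
    | ite_false _ k => obtain ⟨rfl, rfl⟩ := ih k; exact ⟨rfl, rfl⟩
  | loop_true hb _ _ ih ih' =>
    cases h₂ with
    | loop_true _ k k' =>
      obtain ⟨rfl, rfl⟩ := ih k
      obtain ⟨rfl, rfl⟩ := ih' k'
      exact ⟨rfl, rfl⟩
    | loop_false hb' => simp [hb] at hb'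
  | loop_false hb =>
    cases h₂ with
    | loop_true hb' _ _ => simp [hb] at hb'
    | loop_false _ => exact ⟨rfl, rfl⟩

end Semantics

/-- Initial register contents: the four inputs in registers `0` to `3`, and `0` elsewhere. -/
def initRegs (w a b c d : ℕ) : Regs w
  | 0 => BitVec.ofNat w a
  | 1 => BitVec.ofNat w b
  | 2 => BitVec.ofNat w c
  | 3 => BitVec.ofNat w d
  | _ => 0

end WordRAM

/-- The sum of the values `v i` of those points `p i` that lie in `[x₁, x₂] × [y₁, y₂]`. -/
def rectSum {r : ℕ} {G : Type*} [AddCommGroup G] (p : Fin r → Fin r × Fin r) (v : Fin r → G)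
    (x₁ x₂ y₁ y₂ : Fin r) : G :=
  ∑ i with x₁ ≤ (p i).1 ∧ (p i).1 ≤ x₂ ∧ y₁ ≤ (p i).2 ∧ (p i).2 ≤ y₂, v i

/-! Write `Q = 2 ^ a` for the base, `h` for the number of levels and `lam = b + 1` for the bit
length of `r`. Columns are written with `h` digits in base `Q`. Level `l` arranges the points by the
`l` leading digits of the column and then by row; a reversed column modulo `Q ^ l` encodes exactly
these leading digits. A column lies left of `X` iff at one level, and then at exactly one, it shares
the leading digits of `X` and has a smaller next digit (`sum_digitRev`). On each level one takes the
sum, restricted to smaller digits, over all points in front of a key. Such a prefix also contains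
foreign groups of leading digits, but they cancel between two corners with the same `X`
(`pointIndex_cornerSum_sub`); two half-strips give the rectangle.

On a level the prefix is found by binary search. Its sum starts from a stored sample, kept for every
digit once in `Q * h` points, which is `O(r)` samples over all levels; the rest is scanned.
Coordinates and values are stored for the last level only, so every inspected point must be followed
there by jumps.

A jump over `n` levels is a stable sort by `n` digits. The new rank is therefore a base value
depending on digits and block plus a small rank inside the block (`keyRank_lex`), which costs `O(a *
n + log h)` bits per point (`exists_jumpTable`). The jump from level `l > 0` has as length the
largest power of `Q` dividing `l`, cut off at `h`. If `h ≤ Q ^ K`, then at most `Q * K + 1` jumps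
reach the last level (`levelDepth_le`), while the lengths add up to at most `K * h + 1`
(`sum_jumpLength_le`). Hence `O(K * r)` words and `O(Q ^ 2 * K * lam ^ 2)` steps. Taking `Q` of
order `(log r) ^ (min ε 1 / 2)` and `K = O(max 1 (1 / ε))` gives the theorem.

On the machine side, registers are modelled by natural numbers, and `Run` is a total-correctness
triple with a step budget. -/

namespace WordRAM

/-! ### Word operations as operations on natural numbers -/

/-- Value of a word operation on numbers; only the operations that are used get a value. -/
def BinOp.natEval : BinOp → ℕ → ℕ → ℕ
  | .add, a, b => a + b
  | .sub, a, b => a - b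
  | .mul, a, b => a * b
  | .div, a, b => a / b
  | .mod, a, b => a % b
  | .shr, a, b => a / 2 ^ b
  | _, _, _ => 0

/-- Side condition under which `BinOp.natEval` describes the operation on words. -/
def BinOp.natOk (W : ℕ) : BinOp → ℕ → ℕ → Prop
  | .add, _, _ => True
  | .sub, a, b => b ≤ a
  | .mul, _, _ => True
  | .div, a, b => a < W ∧ b < W
  | .mod, a, b => a < W ∧ b < W
  | .shr, a, b => a < W ∧ b < W
  | _, _, _ => False

/-- Words are residues modulo `2 ^ w`, so sums and products need no bound, and differences only must
not truncate. Division, remainder and shift depend on the representative, hence their operands must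
be below `2 ^ w`. -/
theorem BinOp.eval_ofNat {w : ℕ} (o : BinOp) (a b : ℕ) (h : o.natOk (2 ^ w) a b) :
    o.eval (BitVec.ofNat w a) (BitVec.ofNat w b) = BitVec.ofNat w (o.natEval a b) := by
  cases o with
  | add => simp [BinOp.eval, BinOp.natEval, BitVec.ofNat_add]
  | mul => simp [BinOp.eval, BinOp.natEval, BitVec.ofNat_mul]
  | sub =>
    simp only [BinOp.natOk] at h
    simp only [BinOp.eval, BinOp.natEval]
    obtain ⟨d, rfl⟩ := Nat.exists_eq_add_of_le h
    rw [Nat.add_sub_cancel_left, BitVec.ofNat_add, BitVec.add_comm, BitVec.add_sub_cancel]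
  | div =>
    obtain ⟨ha, hb⟩ := h
    simp [BinOp.eval, BinOp.natEval, Nat.mod_eq_of_lt ha, Nat.mod_eq_of_lt hb]
  | mod =>
    obtain ⟨ha, hb⟩ := h
    simp [BinOp.eval, BinOp.natEval, Nat.mod_eq_of_lt ha, Nat.mod_eq_of_lt hb]
  | shr =>
    obtain ⟨ha, hb⟩ := h
    apply BitVec.eq_of_toNat_eq
    simp only [BinOp.eval, BinOp.natEval, BitVec.toNat_ushiftRight, BitVec.toNat_ofNat,
      Nat.mod_eq_of_lt ha, Nat.mod_eq_of_lt hb, Nat.shiftRight_eq_div_pow]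
    rw [Nat.mod_eq_of_lt (lt_of_le_of_lt (Nat.div_le_self _ _) ha)]
  | _ => exact h.elim

/-! ### Compilation of expressions -/

/-- Arithmetic expressions over registers, memory and group. -/
inductive Expr
  | reg (k : ℕ)
  | lit (n : ℕ)
  | bin (o : BinOp) (e f : Expr)
  | load (e : Expr)
  | gzero
  | gadd (e f : Expr)
  | gneg (e : Expr)

/-- Registers from `tmp` on hold intermediate results of expressions. -/
abbrev tmp : ℕ := 100

/-- Program that puts the value of an expression into register `n`, using registers `≥ n`. -/
def Expr.compile (n : ℕ) : Expr → Prog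
  | .reg k => .seq (.instr (.const n 0)) (.instr (.bin .add n k n))
  | .lit m => .instr (.const n m)
  | .bin o e f =>
    .seq (e.compile n) (.seq (f.compile (n + 1)) (.instr (.bin o n n (n + 1))))
  | .load e => .seq (e.compile n) (.instr (.load n n))
  | .gzero => .instr (.gzero n)
  | .gadd e f =>
    .seq (e.compile n) (.seq (f.compile (n + 1)) (.instr (.gadd n n (n + 1))))
  | .gneg e => .seq (e.compile n) (.instr (.gneg n n))

/-- Number of steps of the compiled expression. -/
def Expr.cost : Expr → ℕ
  | .reg _ => 2
  | .lit _ => 1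
  | .bin _ e f => e.cost + (f.cost + 1)
  | .load e => e.cost + 1
  | .gzero => 1
  | .gadd e f => e.cost + (f.cost + 1)
  | .gneg e => e.cost + 1

/-- Assignment of the value of an expression to a register. -/
def assign (d : ℕ) (e : Expr) : Prog :=
  .seq (e.compile tmp) (.seq (.instr (.const (tmp + 1) 0)) (.instr (.bin .add d tmp (tmp + 1))))

section Semantics

variable {N : ℕ} {G : Type*} [AddCommGroup G]

/-- The group element with a given code (`0` if there is none). -/
def decodeNat (code : G ≃ Fin N) (n : ℕ) : G :=
  if h : n < N then code.symm ⟨n, h⟩ else 0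

@[simp] theorem decodeNat_code (code : G ≃ Fin N) (g : G) :
    decodeNat code (code g : ℕ) = g := by
  simp [decodeNat]

theorem decode_ofNat {w : ℕ} (code : G ≃ Fin N) {n : ℕ} (hn : n < 2 ^ w) :
    decode code (BitVec.ofNat w n) = decodeNat code n := by
  simp [decode, decodeNat, Nat.mod_eq_of_lt hn]

/-- Value of an expression, for memory contents `M` and register contents `σ`. -/
def Expr.eval (M : ℕ → ℕ) (code : G ≃ Fin N) (σ : ℕ → ℕ) : Expr → ℕ
  | .reg k => σ k
  | .lit n => n
  | .bin o e f => o.natEval (e.eval M code σ) (f.eval M code σ)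
  | .load e => M (e.eval M code σ)
  | .gzero => (code 0 : ℕ)
  | .gadd e f =>
    (code (decodeNat code (e.eval M code σ) + decodeNat code (f.eval M code σ)) : ℕ)
  | .gneg e => (code (-decodeNat code (e.eval M code σ)) : ℕ)

/-- Side condition under which the compiled expression computes `Expr.eval` with words below
`W`. -/
def Expr.Ok (W : ℕ) (M : ℕ → ℕ) (code : G ≃ Fin N) (σ : ℕ → ℕ) : Expr → Prop
  | .reg k => k < tmp
  | .lit _ => True
  | .bin o e f => e.Ok W M code σ ∧ f.Ok W M code σ ∧
      o.natOk W (e.eval M code σ) (f.eval M code σ)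
  | .load e => e.Ok W M code σ ∧ e.eval M code σ < W
  | .gzero => True
  | .gadd e f => e.Ok W M code σ ∧ f.Ok W M code σ ∧
      e.eval M code σ < W ∧ f.eval M code σ < W
  | .gneg e => e.Ok W M code σ ∧ e.eval M code σ < W

/-- The memory words that hold given numbers. -/
def words (w : ℕ) (l : List ℕ) : List (BitVec w) := l.map (BitVec.ofNat w)

/-- The number at an address. -/
def cell (l : List ℕ) (i : ℕ) : ℕ := l.getD i 0

theorem words_getD (w : ℕ) (l : List ℕ) (i : ℕ) :
    (words w l).getD i 0 = BitVec.ofNat w (cell l i) := by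
  unfold words cell
  rw [List.getD_eq_getElem?_getD, List.getD_eq_getElem?_getD, List.getElem?_map]
  cases l[i]? <;> simp

/-- The registers below `tmp` hold the numbers `σ`. -/
def Holds (w : ℕ) (s : Regs w) (σ : ℕ → ℕ) : Prop :=
  ∀ k < tmp, s k = BitVec.ofNat w (σ k)

variable {w : ℕ} (l : List ℕ) (code : G ≃ Fin N)

/-- The registers from `n` on act as a stack: the right operand is evaluated one register higher, so
the left one survives. The clause on registers below `n` carries this through the induction and also
protects the program variables. -/
theorem Expr.exec_compile (e : Expr) (n : ℕ) (hn : tmp ≤ n) (s : Regs w) (σ : ℕ → ℕ)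
    (hs : Holds w s σ) (he : e.Ok (2 ^ w) (cell l) code σ) :
    ∃ s' : Regs w, Exec (words w l) code (e.compile n) s s' e.cost ∧
      s' n = BitVec.ofNat w (e.eval (cell l) code σ) ∧ ∀ k < n, s' k = s k := by
  induction e generalizing n s with
  | reg k =>
    refine ⟨_, .seq (.instr _ _) (.instr _ _), ?_, ?_⟩
    · have hk : k ≠ n := by simp only [Expr.Ok] at he; omega
      simp [Instr.dest, Instr.value, BinOp.eval, Expr.eval, hk, hs k he]
    · intro k hk
      simp [Instr.dest, hk.ne]
  | lit m =>
    refine ⟨_, .instr _ _, ?_, ?_⟩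
    · simp [Instr.dest, Instr.value, Expr.eval]
    · intro k hk
      simp [Instr.dest, hk.ne]
  | gzero =>
    refine ⟨_, .instr _ _, ?_, ?_⟩
    · simp [Instr.dest, Instr.value, Expr.eval, encode]
    · intro k hk
      simp [Instr.dest, hk.ne]
  | bin o e f ihe ihf =>
    obtain ⟨h1, h2, h3⟩ := he
    obtain ⟨s1, x1, v1, k1⟩ := ihe n hn s hs h1
    obtain ⟨s2, x2, v2, k2⟩ := ihf (n + 1) (by omega) s1
      (fun k hk => (k1 k (by omega)).trans (hs k hk)) h2
    refine ⟨_, .seq x1 (.seq x2 (.instr _ _)), ?_, ?_⟩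
    · simp only [Instr.dest, Function.update_self, Instr.value, Expr.eval]
      rw [k2 n (by omega), v1, v2, BinOp.eval_ofNat _ _ _ h3]
    · intro k hk
      simp only [Instr.dest]
      rw [Function.update_of_ne hk.ne, k2 k (by omega), k1 k hk]
  | load e ihe =>
    obtain ⟨h1, h3⟩ := he
    obtain ⟨s1, x1, v1, k1⟩ := ihe n hn s hs h1
    refine ⟨_, .seq x1 (.instr _ _), ?_, ?_⟩
    · simp only [Instr.dest, Function.update_self, Instr.value, Expr.eval]
      rw [v1, words_getD, BitVec.toNat_ofNat, Nat.mod_eq_of_lt h3]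
    · intro k hk
      simp only [Instr.dest]
      rw [Function.update_of_ne hk.ne, k1 k hk]
  | gadd e f ihe ihf =>
    obtain ⟨h1, h2, h3, h4⟩ := he
    obtain ⟨s1, x1, v1, k1⟩ := ihe n hn s hs h1
    obtain ⟨s2, x2, v2, k2⟩ := ihf (n + 1) (by omega) s1
      (fun k hk => (k1 k (by omega)).trans (hs k hk)) h2
    refine ⟨_, .seq x1 (.seq x2 (.instr _ _)), ?_, ?_⟩
    · simp only [Instr.dest, Function.update_self, Instr.value, Expr.eval]
      rw [k2 n (by omega), v1, v2, decode_ofNat code h3, decode_ofNat code h4, encode]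
    · intro k hk
      simp only [Instr.dest]
      rw [Function.update_of_ne hk.ne, k2 k (by omega), k1 k hk]
  | gneg e ihe =>
    obtain ⟨h1, h3⟩ := he
    obtain ⟨s1, x1, v1, k1⟩ := ihe n hn s hs h1
    refine ⟨_, .seq x1 (.instr _ _), ?_, ?_⟩
    · simp only [Instr.dest, Function.update_self, Instr.value, Expr.eval]
      rw [v1, decode_ofNat code h3, encode]
    · intro k hk
      simp only [Instr.dest]
      rw [Function.update_of_ne hk.ne, k1 k hk]

/-! ### Program logic with step budgets -/

/-- Started with the numbers `σ` in the registers, the program halts after at most `T` steps with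
register contents that satisfy `Post`. -/
def Run (w : ℕ) (l : List ℕ) (code : G ≃ Fin N) (p : Prog) (σ : ℕ → ℕ) (T : ℕ)
    (Post : (ℕ → ℕ) → Prop) : Prop :=
  ∀ s, Holds w s σ → ∃ s' σ' t, Exec (words w l) code p s s' t ∧ Holds w s' σ' ∧ t ≤ T ∧ Post σ'

variable {l code} {σ : ℕ → ℕ} {Post Post' : (ℕ → ℕ) → Prop} {T T' : ℕ} {p q : Prog}

theorem Run.mono (h : Run w l code p σ T Post) (hT : T ≤ T') (hP : ∀ σ', Post σ' → Post' σ') :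
    Run w l code p σ T' Post' := by
  intro s hs
  obtain ⟨s', σ', t, h1, h2, h3, h4⟩ := h s hs
  exact ⟨s', σ', t, h1, h2, h3.trans hT, hP _ h4⟩

theorem Run.seq (h : Run w l code p σ T fun σ' => Run w l code q σ' T' Post) :
    Run w l code (.seq p q) σ (T + T') Post := by
  intro s hs
  obtain ⟨s', σ', t, h1, h2, h3, h4⟩ := h s hs
  obtain ⟨s'', σ'', t', k1, k2, k3, k4⟩ := h4 s' h2
  exact ⟨s'', σ'', t + t', .seq h1 k1, k2, by omega, k4⟩

theorem Run.skip (hT : 1 ≤ T) (h : Post σ) : Run w l code .skip σ T Post :=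
  fun s hs => ⟨s, σ, 1, .skip s, hs, hT, h⟩

theorem Run.assign {d : ℕ} {e : Expr} (hd : d < tmp) (he : e.Ok (2 ^ w) (cell l) code σ)
    (h : Post (Function.update σ d (e.eval (cell l) code σ))) :
    Run w l code (assign d e) σ (e.cost + 2) Post := by
  intro s hs
  obtain ⟨s1, x1, v1, k1⟩ := e.exec_compile l code tmp le_rfl s σ hs he
  refine ⟨_, _, _, .seq x1 (.seq (.instr _ _) (.instr _ _)), ?_, le_rfl, h⟩
  intro k hk
  simp only [Instr.dest, Instr.value, BinOp.eval]
  by_cases hkd : k = d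
  · subst hkd
    simp [v1]
  · rw [Function.update_of_ne hkd, Function.update_of_ne (by omega), Function.update_of_ne hkd,
      k1 k hk, hs k hk]

/-- The total budget stays fixed and the cost of the first program is subtracted from it. A proof
can thus consume a program statement by statement, with the remaining time always explicit. -/
theorem Run.seq_sub (T₁ : ℕ) (hT : T₁ ≤ T)
    (h : Run w l code p σ T₁ fun σ' => Run w l code q σ' (T - T₁) Post) :
    Run w l code (.seq p q) σ T Post :=
  (Run.seq h).mono (by omega) fun _ h => h

theorem Run.assign_last {d : ℕ} {e : Expr} (hd : d < tmp) (hT : e.cost + 2 ≤ T)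
    (he : e.Ok (2 ^ w) (cell l) code σ)
    (h : Post (Function.update σ d (e.eval (cell l) code σ))) :
    Run w l code (WordRAM.assign d e) σ T Post :=
  (Run.assign hd he h).mono hT fun _ h => h

theorem Run.assign_seq {d : ℕ} {e : Expr} (hd : d < tmp) (hT : e.cost + 2 ≤ T)
    (he : e.Ok (2 ^ w) (cell l) code σ)
    (h : Run w l code q (Function.update σ d (e.eval (cell l) code σ)) (T - (e.cost + 2)) Post) :
    Run w l code (.seq (WordRAM.assign d e) q) σ T Post :=
  Run.seq_sub _ hT (Run.assign hd he h)

/-- Value of a test on numbers. -/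
def Test.natEval (σ : ℕ → ℕ) : Test → Prop
  | .lt a b => σ a < σ b
  | .eq a b => σ a = σ b

/-- Side condition under which `Test.natEval` describes the test on words. -/
def Test.Ok (W : ℕ) (σ : ℕ → ℕ) : Test → Prop
  | .lt a b => (a < tmp ∧ σ a < W) ∧ b < tmp ∧ σ b < W
  | .eq a b => (a < tmp ∧ σ a < W) ∧ b < tmp ∧ σ b < W

theorem Test.eval_iff {b : Test} {s : Regs w} (hs : Holds w s σ) (hb : b.Ok (2 ^ w) σ) :
    b.eval s = true ↔ b.natEval σ := by
  cases b with
  | lt a b =>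
    obtain ⟨⟨h1, h2⟩, h3, h4⟩ := hb
    simp [Test.eval, Test.natEval, hs a h1, hs b h3, Nat.mod_eq_of_lt h2, Nat.mod_eq_of_lt h4]
  | eq a b =>
    obtain ⟨⟨h1, h2⟩, h3, h4⟩ := hb
    simp only [Test.eval, Test.natEval, hs a h1, hs b h3, decide_eq_true_eq]
    rw [← BitVec.toNat_inj]
    simp [Nat.mod_eq_of_lt h2, Nat.mod_eq_of_lt h4]

theorem Run.ite {b : Test} (hT : 1 ≤ T) (hb : b.Ok (2 ^ w) σ) (h1 : b.natEval σ → Run w l code p σ (T - 1) Post)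
    (h2 : ¬ b.natEval σ → Run w l code q σ (T - 1) Post) :
    Run w l code (.ite b p q) σ T Post := by
  intro s hs
  by_cases h : b.natEval σ
  · obtain ⟨s', σ', t, k1, k2, k3, k4⟩ := h1 h s hs
    exact ⟨s', σ', t + 1, .ite_true ((Test.eval_iff hs hb).2 h) k1, k2, by omega, k4⟩
  · obtain ⟨s', σ', t, k1, k2, k3, k4⟩ := h2 h s hs
    refine ⟨s', σ', t + 1, .ite_false ?_ k1, k2, by omega, k4⟩
    rw [← Bool.not_eq_true, Test.eval_iff hs hb]
    exact h

/-- A loop whose invariant `I n` allows at most `n` more rounds of `T` steps each. -/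
theorem Run.loop {b : Test} (I : ℕ → (ℕ → ℕ) → Prop)
    (hb : ∀ n σ, I n σ → b.Ok (2 ^ w) σ)
    (hstep : ∀ n σ, I n σ → b.natEval σ →
      Run w l code p σ T fun σ' => ∃ m < n, I m σ')
    (n : ℕ) (hI : I n σ) :
    Run w l code (.loop b p) σ (n * (T + 1) + 1) fun σ' => ¬ b.natEval σ' ∧ ∃ m ≤ n, I m σ' := by
  induction n using Nat.strong_induction_on generalizing σ with
  | _ n ih =>
    intro s hs
    by_cases h : b.natEval σ
    · obtain ⟨s1, σ1, t1, k1, k2, k3, m, hm, k4⟩ := hstep n σ hI h s hs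
      obtain ⟨s2, σ2, t2, j1, j2, j3, j4, m', hm', j5⟩ := ih m hm k4 s1 k2
      refine ⟨s2, σ2, t1 + t2 + 1, .loop_true ((Test.eval_iff hs (hb n σ hI)).2 h) k1 j1, j2, ?_,
        j4, m', by omega, j5⟩
      have : (m + 1) * (T + 1) ≤ n * (T + 1) := Nat.mul_le_mul_right _ hm
      have e : (m + 1) * (T + 1) = m * (T + 1) + (T + 1) := by ring
      omega
    · refine ⟨s, σ, 1, .loop_false ?_, hs, by omega, h, n, le_rfl, hI⟩
      rw [← Bool.not_eq_true, Test.eval_iff hs (hb n σ hI)]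
      exact h

end Semantics

namespace Expr

instance : Add Expr := ⟨.bin .add⟩
instance : Sub Expr := ⟨.bin .sub⟩
instance : Mul Expr := ⟨.bin .mul⟩
instance : Div Expr := ⟨.bin .div⟩
instance : Mod Expr := ⟨.bin .mod⟩
instance (n : ℕ) : OfNat Expr n := ⟨.lit n⟩

/-- Right shift. -/
def shr (e f : Expr) : Expr := .bin .shr e f

section

variable {N : ℕ} {G : Type*} [AddCommGroup G] (W : ℕ) (M : ℕ → ℕ) (code : G ≃ Fin N) (σ : ℕ → ℕ)
  (e f : Expr)

@[simp] theorem cost_add : (e + f).cost = e.cost + (f.cost + 1) := rfl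
@[simp] theorem cost_sub : (e - f).cost = e.cost + (f.cost + 1) := rfl
@[simp] theorem cost_mul : (e * f).cost = e.cost + (f.cost + 1) := rfl
@[simp] theorem cost_div : (e / f).cost = e.cost + (f.cost + 1) := rfl
@[simp] theorem cost_mod : (e % f).cost = e.cost + (f.cost + 1) := rfl
@[simp] theorem cost_shr : (e.shr f).cost = e.cost + (f.cost + 1) := rfl
@[simp] theorem cost_reg (k : ℕ) : (reg k).cost = 2 := rfl
@[simp] theorem cost_ofNat (n : ℕ) : (no_index (OfNat.ofNat n : Expr)).cost = 1 := rfl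
@[simp] theorem cost_load : (load e).cost = e.cost + 1 := rfl
@[simp] theorem cost_gzero : gzero.cost = 1 := rfl
@[simp] theorem cost_gadd : (gadd e f).cost = e.cost + (f.cost + 1) := rfl
@[simp] theorem cost_gneg : (gneg e).cost = e.cost + 1 := rfl
@[simp] theorem eval_add : (e + f).eval M code σ = e.eval M code σ + f.eval M code σ := rfl
@[simp] theorem eval_sub : (e - f).eval M code σ = e.eval M code σ - f.eval M code σ := rfl
@[simp] theorem eval_mul : (e * f).eval M code σ = e.eval M code σ * f.eval M code σ := rfl
@[simp] theorem eval_div : (e / f).eval M code σ = e.eval M code σ / f.eval M code σ := rfl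
@[simp] theorem eval_mod : (e % f).eval M code σ = e.eval M code σ % f.eval M code σ := rfl
@[simp] theorem eval_shr :
    (e.shr f).eval M code σ = e.eval M code σ / 2 ^ f.eval M code σ := rfl
@[simp] theorem eval_reg (k : ℕ) : (reg k).eval M code σ = σ k := rfl
@[simp] theorem eval_load : (load e).eval M code σ = M (e.eval M code σ) := rfl
@[simp] theorem eval_gzero : gzero.eval M code σ = code 0 := rfl
@[simp] theorem eval_gadd : (gadd e f).eval M code σ =
    code (decodeNat code (e.eval M code σ) + decodeNat code (f.eval M code σ)) := rfl
@[simp] theorem eval_gneg : (gneg e).eval M code σ = code (-decodeNat code (e.eval M code σ)) :=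
  rfl
@[simp] theorem ok_add : (e + f).Ok W M code σ ↔ e.Ok W M code σ ∧ f.Ok W M code σ := by
  change _ ∧ _ ∧ True ↔ _; simp
@[simp] theorem ok_mul : (e * f).Ok W M code σ ↔ e.Ok W M code σ ∧ f.Ok W M code σ := by
  change _ ∧ _ ∧ True ↔ _; simp
@[simp] theorem ok_sub : (e - f).Ok W M code σ ↔ e.Ok W M code σ ∧ f.Ok W M code σ ∧
    f.eval M code σ ≤ e.eval M code σ := Iff.rfl
@[simp] theorem ok_div : (e / f).Ok W M code σ ↔ e.Ok W M code σ ∧ f.Ok W M code σ ∧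
    e.eval M code σ < W ∧ f.eval M code σ < W := Iff.rfl
@[simp] theorem ok_mod : (e % f).Ok W M code σ ↔ e.Ok W M code σ ∧ f.Ok W M code σ ∧
    e.eval M code σ < W ∧ f.eval M code σ < W := Iff.rfl
@[simp] theorem ok_shr : (e.shr f).Ok W M code σ ↔ e.Ok W M code σ ∧ f.Ok W M code σ ∧
    e.eval M code σ < W ∧ f.eval M code σ < W := Iff.rfl
@[simp] theorem ok_reg (k : ℕ) : (reg k).Ok W M code σ ↔ k < 100 := Iff.rfl
@[simp] theorem ok_load : (load e).Ok W M code σ ↔ e.Ok W M code σ ∧ e.eval M code σ < W := Iff.rfl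
@[simp] theorem ok_gzero : gzero.Ok W M code σ ↔ True := Iff.rfl
@[simp] theorem ok_gadd : (gadd e f).Ok W M code σ ↔ e.Ok W M code σ ∧ f.Ok W M code σ ∧
    e.eval M code σ < W ∧ f.eval M code σ < W := Iff.rfl
@[simp] theorem ok_gneg : (gneg e).Ok W M code σ ↔ e.Ok W M code σ ∧ e.eval M code σ < W := Iff.rfl

@[simp] theorem eval_ofNat (n : ℕ) : (no_index (OfNat.ofNat n : Expr)).eval M code σ = n := rfl
@[simp] theorem ok_ofNat (n : ℕ) : (no_index (OfNat.ofNat n : Expr)).Ok W M code σ ↔ True := Iff.rfl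

end

end Expr

open WordRAM.Expr

/-! The query program. Registers 10 to 22 hold the parameters: number of levels, base, number of
points, its square, first step width of the binary search, the addresses of the arrays of reversed
columns, of rows, of values, of the reversal table and of the sampled sums, the number of blocks
per level, the block length, and zero. -/

/-- One jump: registers 50 and 51 hold a level and a position there. -/
def jumpProg : Prog :=
  .seq (assign 52 (16 + 8 * reg 50)) <|
  .seq (assign 53 ((load (load (reg 52 + 1) + reg 51 / load (reg 52 + 2))).shr
    (reg 51 % load (reg 52 + 2) * load (reg 52 + 3)) % load (reg 52 + 4))) <|
  .seq (assign 51 (load (load (reg 52 + 7) + reg 51 / load (reg 52 + 5) * load (reg 52 + 6)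
    + reg 53 / load (reg 52 + 5)) + reg 53 % load (reg 52 + 5)))
  (assign 50 (load (reg 52)))

/-- Follow the jumps down to the last level. -/
def descendProg : Prog := .loop (.lt 50 10) jumpProg

/-- One round of the binary search for the number of points below the target in register 35. -/
def searchStep : Prog :=
  .seq (assign 42 (reg 40 + reg 41)) <|
  .seq (.ite (.lt 12 42) .skip <|
    .seq (assign 50 (reg 32)) <|
    .seq (assign 51 (reg 42 - 1)) <|
    .seq descendProg <|
    .seq (assign 45 (load (reg 15 + reg 51) % reg 33 * reg 13 + load (reg 16 + reg 51)))
    (.ite (.lt 45 35) (assign 40 (reg 42)) .skip))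
  (assign 41 (reg 41 / 2))

/-- One round of the summation over the points after the last sample. -/
def scanStep : Prog :=
  .seq (assign 50 (reg 32)) <|
  .seq (assign 51 (reg 43)) <|
  .seq descendProg <|
  .seq (assign 46 (load (reg 15 + reg 51) / reg 33 % reg 11)) <|
  .seq (.ite (.lt 46 36) (assign 44 (gadd (reg 44) (load (reg 17 + reg 51)))) .skip)
  (assign 43 (reg 43 + 1))

/-- The contribution of one level. -/
def levelProg : Prog :=
  .seq (assign 35 (reg 30 % reg 33 * reg 13 + reg 31)) <|
  .seq (assign 36 (reg 30 / reg 33 % reg 11)) <|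
  .seq (assign 40 0) <|
  .seq (assign 41 (reg 14)) <|
  .seq (.loop (.lt 22 41) searchStep) <|
  -- Round the length of the prefix down to a multiple of the block length, where a sample is
  -- stored.
  .seq (assign 43 (reg 40 / reg 21 * reg 21)) <|
  .seq (assign 44 (load (reg 19 + (reg 32 * reg 20 + reg 40 / reg 21) * reg 11 + reg 36))) <|
  .seq (.loop (.lt 43 40) scanStep) <|
  .seq (assign 34 (gadd (reg 34) (reg 44))) <|
  .seq (assign 33 (reg 33 * reg 11))
  (assign 32 (reg 32 + 1))

/-- The contribution of one corner `(X, Y)` of the rectangle. -/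
def cornerProg (X Y : Expr) : Prog :=
  .seq (assign 30 (load (reg 18 + X))) <|
  .seq (assign 31 (Y * reg 12)) <|
  .seq (assign 32 0) <|
  .seq (assign 33 1) <|
  .seq (assign 34 gzero)
  (.loop (.lt 32 10) levelProg)

/-- Load the parameters. -/
def setupProg : Prog :=
  .seq (assign 10 (load 0)) <|
  .seq (assign 11 (load 1)) <|
  .seq (assign 12 (load 2)) <|
  .seq (assign 13 (reg 12 * reg 12)) <|
  .seq (assign 14 (load 3)) <|
  .seq (assign 15 (load 4)) <|
  .seq (assign 16 (load 5)) <|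
  .seq (assign 17 (load 6)) <|
  .seq (assign 18 (load 7)) <|
  .seq (assign 19 (load 8)) <|
  .seq (assign 20 (load 9)) <|
  .seq (assign 21 (load 10))
  (assign 22 0)

/-- Combine the four corners of a non-empty rectangle; register 4 accumulates the result. -/
def combineProg : Prog :=
  .seq (assign 4 gzero) <|
  .seq (.seq (cornerProg (reg 1 + 1) (reg 3 + 1)) (assign 4 (gadd (reg 4) (reg 34)))) <|
  .seq (.seq (cornerProg (reg 1 + 1) (reg 2)) (assign 4 (gadd (reg 4) (gneg (reg 34))))) <|
  .seq (.seq (cornerProg (reg 0) (reg 3 + 1)) (assign 4 (gadd (reg 4) (gneg (reg 34))))) <|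
  .seq (.seq (cornerProg (reg 0) (reg 2)) (assign 4 (gadd (reg 4) (reg 34))))
  (assign 0 (reg 4))

/-- The whole query. -/
def queryProg : Prog :=
  .ite (.lt 1 0) (assign 0 gzero) <|
  .ite (.lt 3 2) (assign 0 gzero) <|
  .seq setupProg combineProg

/-! ### Specification of the data structure and of its representation in memory -/

/-- What the memory describes: `level` levels in base `base` for `size` points; `next` and `jump`
lead from a position of a level to a position of a later level; `col`, `row` and `val` describe
the points in the order of the last level. -/
structure Index (G : Type*) where
  level : ℕ
  base : ℕ
  size : ℕ
  half : ℕ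
  bits : ℕ
  blocks : ℕ
  block : ℕ
  next : ℕ → ℕ
  jump : ℕ → ℕ → ℕ
  col : ℕ → ℕ
  row : ℕ → ℕ
  val : ℕ → G
  rev : ℕ → ℕ
  sample : ℕ → ℕ → ℕ → G
  /-- the position at the last level of the point at a given position of a level -/
  last : ℕ → ℕ → ℕ
  /-- a bound for the number of jumps from a level -/
  depth : ℕ → ℕ

namespace Index

variable {G : Type*} [AddCommGroup G] (D : Index G)

/-- Sort key of a point of the last level. -/
def key (l i : ℕ) : ℕ := D.col i % D.base ^ l * (D.size * D.size) + D.row i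

/-- Digit of a reversed column. -/
def digit (l x : ℕ) : ℕ := x / D.base ^ l % D.base

/-- Sum over the first `n` points of a level whose digit is below `c`. -/
def psum (l c n : ℕ) : G :=
  ∑ j ∈ Finset.range n, if D.digit l (D.col (D.last l j)) < c then D.val (D.last l j) else 0

/-- Contribution of a level to the sum over the points left of and below a corner. -/
def levelSum (x y l : ℕ) : G :=
  ∑ j ∈ Finset.range D.size,
    if D.key l (D.last l j) < x % D.base ^ l * (D.size * D.size) + y ∧
      D.digit l (D.col (D.last l j)) < D.digit l x then D.val (D.last l j) else 0

/-- Consistency of the parts of an index. -/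
structure Valid : Prop where
  base_pos : 0 < D.base
  block_pos : 0 < D.block
  half_eq : D.half = 2 ^ D.bits
  size_lt : D.size < 2 ^ (D.bits + 1)
  next_le : ∀ l < D.level, D.next l ≤ D.level
  jump_lt : ∀ l < D.level, ∀ i < D.size, D.jump l i < D.size
  depth_lt : ∀ l < D.level, D.depth (D.next l) < D.depth l
  last_level : ∀ i < D.size, D.last D.level i = i
  last_jump : ∀ l < D.level, ∀ i < D.size, D.last (D.next l) (D.jump l i) = D.last l i
  last_lt : ∀ l < D.level, ∀ i < D.size, D.last l i < D.size
  sorted : ∀ l < D.level, ∀ i j, i ≤ j → j < D.size →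
    D.key l (D.last l i) ≤ D.key l (D.last l j)
  col_lt : ∀ i < D.size, D.col i < D.base ^ D.level
  row_lt : ∀ i < D.size, D.row i < D.size * D.size
  rev_lt : ∀ x ≤ D.size, D.rev x < D.base ^ D.level
  sample_eq : ∀ l < D.level, ∀ b, b * D.block ≤ D.size → ∀ c < D.base,
    D.sample l b c = D.psum l c (b * D.block)

/-- The cells `M`, all below `W`, hold the index. -/
structure Stored {N : ℕ} (code : G ≃ Fin N) (W : ℕ) (M : ℕ → ℕ) : Prop where
  lt : ∀ i, M i < W
  card_le : N ≤ W
  const_lt : 100 < W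
  key_lt : D.base ^ D.level * (D.size * D.size) < W
  level_lt : D.level < W
  base_lt : D.base < W
  block_lt : D.block < W
  pow_lt : D.base ^ D.level < W
  half_lt : D.size + 2 * D.half < W
  level_eq : M 0 = D.level
  base_eq : M 1 = D.base
  size_eq : M 2 = D.size
  half_eq : M 3 = D.half
  blocks_eq : M 9 = D.blocks
  block_eq : M 10 = D.block
  col : ∀ i < D.size, M 4 + i < W ∧ M (M 4 + i) = D.col i
  row : ∀ i < D.size, M 5 + i < W ∧ M (M 5 + i) = D.row i
  val : ∀ i < D.size, M 6 + i < W ∧ M (M 6 + i) = code (D.val i)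
  rev : ∀ x ≤ D.size, M 7 + x < W ∧ M (M 7 + x) = D.rev x
  sample : ∀ l < D.level, ∀ b, b * D.block ≤ D.size → ∀ c < D.base,
    M 8 + (l * D.blocks + b) * D.base + c < W ∧
    M (M 8 + (l * D.blocks + b) * D.base + c) = code (D.sample l b c)
  descr_lt : ∀ l < D.level, 16 + 8 * l + 7 < W
  next : ∀ l < D.level, M (16 + 8 * l) = D.next l
  entry_lt : ∀ l < D.level, ∀ i < D.size,
    M (16 + 8 * l + 1) + i / M (16 + 8 * l + 2) < W ∧
    i % M (16 + 8 * l + 2) * M (16 + 8 * l + 3) < W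
  jump : ∀ l < D.level, ∀ i < D.size, ∀ e,
    e = M (M (16 + 8 * l + 1) + i / M (16 + 8 * l + 2)) /
      2 ^ (i % M (16 + 8 * l + 2) * M (16 + 8 * l + 3)) % M (16 + 8 * l + 4) →
    M (16 + 8 * l + 7) + i / M (16 + 8 * l + 5) * M (16 + 8 * l + 6) + e / M (16 + 8 * l + 5) < W ∧
    M (M (16 + 8 * l + 7) + i / M (16 + 8 * l + 5) * M (16 + 8 * l + 6) + e / M (16 + 8 * l + 5))
      + e % M (16 + 8 * l + 5) = D.jump l i

end Index

/-! ### Correctness and running time of the query program -/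

section Correctness

variable {G : Type*} [AddCommGroup G] {D : Index G} {N w : ℕ} {code : G ≃ Fin N} {m : List ℕ}
  {σ : ℕ → ℕ}

/-- `Index.Stored.jump` is phrased with exactly the address arithmetic of the program, so symbolic
execution suffices. The constant 100 is generous, like the later ones; only orders of magnitude
matter. -/
theorem run_jumpProg (hM : D.Stored code (2 ^ w) (cell m)) {l i : ℕ}
    (hl : l < D.level) (hi : i < D.size) (h50 : σ 50 = l) (h51 : σ 51 = i) :
    Run w m code jumpProg σ 100 fun σ' =>
      σ' 50 = D.next l ∧ σ' 51 = D.jump l i ∧ ∀ k < 50, σ' k = σ k := by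
  have hlt := hM.lt
  have hd := hM.descr_lt l hl
  have hiW : i < 2 ^ w := by have := hM.half_lt; omega
  obtain ⟨e1, e2⟩ := hM.entry_lt l hl i hi
  have hjump := hM.jump l hl i hi _ rfl
  have hentry : cell m (cell m (16 + 8 * l + 1) + i / cell m (16 + 8 * l + 2)) /
      2 ^ (i % cell m (16 + 8 * l + 2) * cell m (16 + 8 * l + 3)) % cell m (16 + 8 * l + 4)
      < 2 ^ w :=
    (Nat.mod_le _ _).trans_lt ((Nat.div_le_self _ _).trans_lt (hlt _))
  refine Run.assign_seq (by norm_num) (by simp) (by simp) ?_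
  refine Run.assign_seq (by norm_num) (by simp) ?_ ?_
  · simp [h50, h51, hlt, hiW, e1, e2, (Nat.div_le_self _ _).trans_lt (hlt _)]
    omega
  refine Run.assign_seq (by norm_num) (by simp) ?_ ?_
  · simp [h50, h51, hlt, hiW, hentry, hjump.1]
    omega
  refine Run.assign_last (by norm_num) (by simp) ?_ ⟨?_, ?_, ?_⟩
  · simp [h50]; omega
  · simp [h50, hM.next l hl]
  · simp [h50, h51, hjump.2]
  · intro k hk
    simp [show k ≠ 50 by omega, show k ≠ 51 by omega, show k ≠ 52 by omega,
      show k ≠ 53 by omega]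

/-- A jump does not change the position that the point finally has on the last level, so `last` is
the loop invariant; there it is the identity. The strictly decreasing `depth` bounds the number of
rounds, each costing 100 steps and one test. -/
theorem run_descendProg (hD : D.Valid) (hM : D.Stored code (2 ^ w) (cell m)) {l i d : ℕ}
    (hl : l < D.level) (hd : D.depth l ≤ d) (hi : i < D.size) (h10 : σ 10 = D.level)
    (h50 : σ 50 = l) (h51 : σ 51 = i) :
    Run w m code descendProg σ (d * 101 + 1) fun σ' =>
      σ' 51 = D.last l i ∧ ∀ k < 50, σ' k = σ k := by
  let I : ℕ → (ℕ → ℕ) → Prop := fun n τ => D.depth (τ 50) ≤ n ∧ τ 50 ≤ D.level ∧ τ 51 < D.size ∧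
    D.last (τ 50) (τ 51) = D.last l i ∧ ∀ k < 50, τ k = σ k
  have hlev := hM.level_lt
  refine (Run.loop (T := 100) I ?_ ?_ d ?_).mono le_rfl ?_
  · rintro n τ ⟨-, h1, -, -, h2⟩
    have := h2 10 (by norm_num)
    simp only [Test.Ok, tmp]
    omega
  · rintro n τ ⟨h0, h1, h2, h3, h4⟩ hlt
    simp only [Test.natEval, h4 10 (by norm_num), h10] at hlt
    refine (run_jumpProg hM hlt h2 rfl rfl).mono le_rfl ?_
    rintro τ' ⟨k1, k2, k3⟩
    refine ⟨D.depth (D.next (τ 50)), (hD.depth_lt _ hlt).trans_le h0, ?_⟩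
    refine ⟨by rw [k1], k1 ▸ hD.next_le _ hlt, k2 ▸ hD.jump_lt _ hlt _ h2, ?_, ?_⟩
    · rw [k1, k2, hD.last_jump _ hlt _ h2, h3]
    · exact fun k hk => (k3 k hk).trans (h4 k hk)
  · exact ⟨h50 ▸ hd, h50 ▸ hl.le, h51 ▸ hi, by rw [h50, h51], fun _ _ => rfl⟩
  · rintro τ ⟨h1, n, -, -, h2, h3, h4, h5⟩
    refine ⟨?_, h5⟩
    simp only [Test.natEval, h5 10 (by norm_num), h10] at h1
    rw [show τ 50 = D.level by omega, hD.last_level _ h3] at h4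
    exact h4

/-- The registers hold the parameters of the index. -/
structure Index.Loaded (D : Index G) (M σ : ℕ → ℕ) : Prop where
  level : σ 10 = D.level
  base : σ 11 = D.base
  size : σ 12 = D.size
  size_sq : σ 13 = D.size * D.size
  half : σ 14 = D.half
  col : σ 15 = M 4
  row : σ 16 = M 5
  val : σ 17 = M 6
  rev : σ 18 = M 7
  sample : σ 19 = M 8
  blocks : σ 20 = D.blocks
  block : σ 21 = D.block
  zero : σ 22 = 0

omit [AddCommGroup G] in
theorem Index.Loaded.of_agree {M τ : ℕ → ℕ} (h : D.Loaded M σ) (hτ : ∀ k < 30, τ k = σ k) :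
    D.Loaded M τ := by
  constructor <;> rw [hτ _ (by norm_num)]
  exacts [h.level, h.base, h.size, h.size_sq, h.half, h.col, h.row, h.val, h.rev, h.sample,
    h.blocks, h.block, h.zero]

theorem Index.Valid.key_lt (hD : D.Valid) {l i : ℕ} (hl : l ≤ D.level) (hi : i < D.size) :
    D.key l i < D.base ^ D.level * (D.size * D.size) := by
  have h1 : D.col i % D.base ^ l < D.base ^ l := Nat.mod_lt _ (pow_pos hD.base_pos _)
  have h2 : D.base ^ l ≤ D.base ^ D.level := Nat.pow_le_pow_right hD.base_pos hl
  have h3 := hD.row_lt i hi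
  unfold Index.key
  calc _ < D.col i % D.base ^ l * (D.size * D.size) + 1 * (D.size * D.size) := by omega
    _ = (D.col i % D.base ^ l + 1) * (D.size * D.size) := by ring
    _ ≤ _ := Nat.mul_le_mul_right _ (by omega)

theorem Index.Valid.pow_lt {W : ℕ} {M : ℕ → ℕ} (hD : D.Valid) (hM : D.Stored code W M) {l : ℕ}
    (hl : l ≤ D.level) : D.base ^ l < W :=
  (Nat.pow_le_pow_right hD.base_pos hl).trans_lt hM.pow_lt

/-- The unknown `cnt` lies in a window of length `2 ^ (n + 1)` beginning at register 40; the probe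
decides in which half. -/
theorem run_searchStep (hD : D.Valid) (hM : D.Stored code (2 ^ w) (cell m)) {l d cnt n t : ℕ}
    (hl : l < D.level) (hd : D.depth l ≤ d) (hσ : D.Loaded (cell m) σ) (h32 : σ 32 = l)
    (h33 : σ 33 = D.base ^ l) (h35 : σ 35 = t) (ht : t < 2 ^ w)
    (hcnt : ∀ i < D.size, D.key l (D.last l i) < t ↔ i < cnt) (hcs : cnt ≤ D.size)
    (hlo : σ 40 ≤ cnt) (hhi : cnt < σ 40 + 2 ^ (n + 1)) (h41 : σ 41 = 2 ^ n)
    (hn : 2 ^ n ≤ D.half) :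
    Run w m code searchStep σ (d * 101 + 100) fun σ' =>
      (σ' 40 ≤ cnt ∧ cnt < σ' 40 + 2 ^ n ∧ σ' 41 = 2 ^ n / 2) ∧ ∀ k < 40, σ' k = σ k := by
  have hsw := hM.half_lt
  have h2n : 0 < 2 ^ n := by positivity
  have hc := hM.const_lt
  refine Run.assign_seq (by norm_num) (by simp) (by simp) ?_
  simp only [eval_add, eval_reg]
  refine Run.seq_sub (d * 101 + 50) (by simp) (Run.mono (T := d * 101 + 50)
    (Post := fun σ' => (σ' 40 ≤ cnt ∧ cnt < σ' 40 + 2 ^ n ∧ σ' 41 = 2 ^ n) ∧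
      ∀ k < 40, σ' k = σ k) ?_ le_rfl ?_)
  · rw [pow_succ] at hhi
    refine Run.ite (by simp) ?_ ?_ ?_
    · simp [Test.Ok, tmp, hσ.size, h41]
      omega
    · intro h
      -- The probe lies beyond the last point, so `cnt` is in the lower half and nothing has to be
      -- read.
      simp [Test.natEval, hσ.size, h41] at h
      refine Run.skip (by simp) ⟨⟨?_, ?_, ?_⟩, ?_⟩
      · simpa using hlo
      · simp; omega
      · simpa using h41
      · intro k hk
        simp [show k ≠ 42 by omega]
    · intro h
      simp [Test.natEval, hσ.size, h41] at h
      -- Positions start at 0: at least `σ 40 + 2 ^ n` points are below the target iff the point at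
      -- this position is.
      have hi : σ 40 + 2 ^ n - 1 < D.size := by omega
      refine Run.assign_seq (by norm_num) (by simp) (by simp) ?_
      refine Run.assign_seq (by norm_num) (by simp) ?_ ?_
      · simp [h41]; omega
      refine Run.seq_sub (d * 101 + 1) (by simp) ?_
      refine (run_descendProg hD hM (l := l) (i := σ 40 + 2 ^ n - 1) hl hd hi ?_ ?_ ?_).mono
        le_rfl ?_
      · simp [hσ.level]
      · simp [h32]
      · simp [h41]
      rintro τ ⟨h1, h2⟩
      have hlast := hD.last_lt l hl _ hi
      have hτ : ∀ k < 42, τ k = σ k := by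
        intro k hk
        rw [h2 k (by omega)]
        simp [show k ≠ 42 by omega, show k ≠ 50 by omega, show k ≠ 51 by omega]
      have hτ42 : τ 42 = σ 40 + 2 ^ n := by
        rw [h2 42 (by omega)]
        simp [h41]
      have e15 := (hτ 15 (by norm_num)).trans hσ.col
      have e16 := (hτ 16 (by norm_num)).trans hσ.row
      have e13 := (hτ 13 (by norm_num)).trans hσ.size_sq
      have e33 := (hτ 33 (by norm_num)).trans h33
      have e35 := (hτ 35 (by norm_num)).trans h35
      have e40 := hτ 40 (by norm_num)
      have e41 := (hτ 41 (by norm_num)).trans h41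
      obtain ⟨c1, c2⟩ := hM.col _ hlast
      obtain ⟨c3, c4⟩ := hM.row _ hlast
      have hcol := hD.col_lt _ hlast
      have hpow := hM.pow_lt
      refine Run.assign_seq (by norm_num) (by simp) ?_ ?_
      · simp [e15, e16, h1, c1, c2, c3, e33, hD.pow_lt hM hl.le, hcol.trans hpow]
      have hk : D.col (D.last l (σ 40 + 2 ^ n - 1)) % D.base ^ l * (D.size * D.size) +
          D.row (D.last l (σ 40 + 2 ^ n - 1)) = D.key l (D.last l (σ 40 + 2 ^ n - 1)) := rfl
      simp only [eval_add, eval_mul, eval_mod, eval_load, eval_reg, e15, e16, h1, c2, c4, e33, e13,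
        hk]
      have hkey := (hD.key_lt hl.le hlast).trans hM.key_lt
      refine Run.ite (by simp) ?_ ?_ ?_
      · simp [Test.Ok, tmp, hkey, e35, ht]
      · intro h'
        simp [Test.natEval, e35] at h'
        have := (hcnt _ hi).1 h'
        refine Run.assign_last (by norm_num) (by simp) (by simp) ⟨⟨?_, ?_, ?_⟩, ?_⟩
        · simp [hτ42]; omega
        · simp [hτ42]; omega
        · simp [e41]
        · intro k hk
          simp [show k ≠ 40 by omega, show k ≠ 45 by omega, hτ k (by omega)]
      · intro h'
        simp [Test.natEval, e35] at h'
        rw [← not_lt, hcnt _ hi] at h'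
        refine Run.skip (by simp) ⟨⟨?_, ?_, ?_⟩, ?_⟩
        · simp [e40, hlo]
        · simp [e40]; omega
        · simp [e41]
        · intro k hk
          simp [show k ≠ 45 by omega, hτ k (by omega)]
  · rintro τ ⟨⟨h1, h2, h3⟩, h4⟩
    refine Run.assign_last (by norm_num) (by simp) ?_ ⟨⟨?_, ?_, ?_⟩, ?_⟩
    · simp [h3]; omega
    · simpa using h1
    · simpa using h2
    · simp [h3]
    · intro k hk
      simp [show k ≠ 41 by omega, h4 k hk]

end Correctness

section Correctness

variable {G : Type*} [AddCommGroup G] {D : Index G} {N w : ℕ} {code : G ≃ Fin N} {m : List ℕ}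
  {σ : ℕ → ℕ}

theorem exists_threshold (P : ℕ → Prop) (n : ℕ) (hP : ∀ i j, i ≤ j → j < n → P j → P i) :
    ∃ c ≤ n, ∀ i < n, P i ↔ i < c := by
  induction n with
  | zero => exact ⟨0, le_rfl, by simp⟩
  | succ n ih =>
    by_cases h : P n
    · exact ⟨n + 1, le_rfl, fun i hi => ⟨fun _ => hi, fun _ => hP i n (by omega) (by omega) h⟩⟩
    · obtain ⟨c, hc, hcP⟩ := ih fun i j hij hj => hP i j hij (by omega)
      refine ⟨c, by omega, fun i hi => ?_⟩
      rcases Nat.lt_succ_iff_lt_or_eq.1 hi with hi | rfl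
      · exact hcP i hi
      · exact ⟨fun h' => absurd h' h, fun h' => by omega⟩

theorem run_search (hD : D.Valid) (hM : D.Stored code (2 ^ w) (cell m)) {l d cnt t : ℕ}
    (hl : l < D.level) (hd : D.depth l ≤ d) (hσ : D.Loaded (cell m) σ) (h32 : σ 32 = l)
    (h33 : σ 33 = D.base ^ l) (h35 : σ 35 = t) (ht : t < 2 ^ w)
    (hcnt : ∀ i < D.size, D.key l (D.last l i) < t ↔ i < cnt) (hcs : cnt ≤ D.size)
    (h40 : σ 40 = 0) (h41 : σ 41 = D.half) :
    Run w m code (.loop (.lt 22 41) searchStep) σ ((D.bits + 1) * (d * 101 + 101) + 1) fun σ' =>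
      σ' 40 = cnt ∧ ∀ k < 40, σ' k = σ k := by
  have hhalf := hM.half_lt
  -- The width is `2 ^ n / 2`, where `n` counts the remaining rounds: for `n = 0` it is 0, which
  -- ends the loop, and the window of length 1 leaves only `cnt`.
  let I : ℕ → (ℕ → ℕ) → Prop := fun n τ => (τ 40 ≤ cnt ∧ cnt < τ 40 + 2 ^ n ∧ τ 41 = 2 ^ n / 2 ∧
    2 ^ n / 2 ≤ D.half) ∧ ∀ k < 40, τ k = σ k
  refine (Run.loop (T := d * 101 + 100) I ?_ ?_ (D.bits + 1) ?_).mono le_rfl ?_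
  · rintro n τ ⟨⟨-, -, h1, h2⟩, h3⟩
    have := h3 22 (by norm_num)
    simp [Test.Ok, tmp, this, hσ.zero]
    omega
  · rintro n τ ⟨⟨h1, h2, h3, h4⟩, h5⟩ hlt
    simp only [Test.natEval, h5 22 (by norm_num), hσ.zero] at hlt
    obtain _ | n := n
    · simp [h3] at hlt
    have e : 2 ^ (n + 1) / 2 = 2 ^ n := by rw [pow_succ]; simp
    rw [e] at h3 h4
    refine (run_searchStep hD hM hl hd (hσ.of_agree fun k hk => h5 k (by omega)) ?_ ?_ ?_ ht hcnt
      hcs h1 h2 h3 h4).mono le_rfl ?_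
    · rw [h5 _ (by norm_num), h32]
    · rw [h5 _ (by norm_num), h33]
    · rw [h5 _ (by norm_num), h35]
    · rintro τ' ⟨⟨k1, k2, k3⟩, k4⟩
      exact ⟨n, by omega, ⟨k1, k2, k3, (Nat.div_le_self _ _).trans h4⟩,
        fun k hk => (k4 k hk).trans (h5 k hk)⟩
  · have e : 2 ^ (D.bits + 1) / 2 = D.half := by rw [pow_succ, hD.half_eq]; simp
    exact ⟨⟨by omega, by have := hD.size_lt; omega, by rw [h41, e], e.le⟩, fun _ _ => rfl⟩
  · rintro τ ⟨h1, n, -, ⟨h2, h3, h4, -⟩, h5⟩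
    refine ⟨?_, h5⟩
    simp only [Test.natEval, h5 22 (by norm_num), hσ.zero] at h1
    obtain _ | n := n
    · simp at h3
      omega
    · have : 2 ^ (n + 1) / 2 = 2 ^ n := by rw [pow_succ]; simp
      have : 0 < 2 ^ n := by positivity
      omega

theorem Index.psum_succ (l c n : ℕ) : D.psum l c (n + 1) = D.psum l c n +
    if D.digit l (D.col (D.last l n)) < c then D.val (D.last l n) else 0 :=
  Finset.sum_range_succ _ _

omit [AddCommGroup G] in
theorem code_lt {W : ℕ} {M : ℕ → ℕ} (hM : D.Stored code W M) (g : G) : (code g : ℕ) < W :=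
  (code g).2.trans_le hM.card_le

theorem run_scanStep (hD : D.Valid) (hM : D.Stored code (2 ^ w) (cell m)) {l d j c : ℕ}
    (hl : l < D.level) (hd : D.depth l ≤ d) (hσ : D.Loaded (cell m) σ) (h32 : σ 32 = l)
    (h33 : σ 33 = D.base ^ l) (h36 : σ 36 = c) (hc : c < D.base) (h43 : σ 43 = j)
    (hj : j < D.size) (h44 : σ 44 = code (D.psum l c j)) :
    Run w m code scanStep σ (d * 101 + 100) fun σ' =>
      (σ' 43 = j + 1 ∧ σ' 44 = code (D.psum l c (j + 1))) ∧ ∀ k < 43, σ' k = σ k := by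
  have hbase := hM.base_lt
  refine Run.assign_seq (by norm_num) (by simp) (by simp) ?_
  refine Run.assign_seq (by norm_num) (by simp) (by simp) ?_
  refine Run.seq_sub (d * 101 + 1) (by simp) ?_
  refine (run_descendProg hD hM (l := l) (i := j) hl hd hj ?_ ?_ ?_).mono le_rfl ?_
  · simp [hσ.level]
  · simp [h32]
  · simp [h43]
  rintro τ ⟨h1, h2⟩
  have hlast := hD.last_lt l hl _ hj
  have hτ : ∀ k < 50, τ k = σ k := by
    intro k hk
    rw [h2 k (by omega)]
    simp [show k ≠ 50 by omega, show k ≠ 51 by omega]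
  have e11 := (hτ 11 (by norm_num)).trans hσ.base
  have e15 := (hτ 15 (by norm_num)).trans hσ.col
  have e17 := (hτ 17 (by norm_num)).trans hσ.val
  have e33 := (hτ 33 (by norm_num)).trans h33
  have e36 := (hτ 36 (by norm_num)).trans h36
  have e43 := (hτ 43 (by norm_num)).trans h43
  have e44 := (hτ 44 (by norm_num)).trans h44
  obtain ⟨c1, c2⟩ := hM.col _ hlast
  obtain ⟨c3, c4⟩ := hM.val _ hlast
  have hcol := (hD.col_lt _ hlast).trans hM.pow_lt
  have hdig : D.col (D.last l j) / D.base ^ l % D.base = D.digit l (D.col (D.last l j)) := rfl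
  have hdlt : D.digit l (D.col (D.last l j)) < D.base := Nat.mod_lt _ hD.base_pos
  refine Run.assign_seq (by norm_num) (by simp) ?_ ?_
  · simp [e15, h1, c1, c2, e33, e11, hD.pow_lt hM hl.le, hcol, hbase,
      (Nat.div_le_self _ _).trans_lt hcol]
  refine Run.seq_sub 20 (by simp) (Run.mono (T := 20)
    (Post := fun σ' => (σ' 43 = j ∧ σ' 44 = code (D.psum l c (j + 1))) ∧
      ∀ k < 43, σ' k = σ k) ?_ le_rfl ?_)
  · simp only [eval_div, eval_mod, eval_load, eval_reg, eval_add, e15, h1, c2, e33, e11, hdig]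
    refine Run.ite (by simp) ?_ ?_ ?_
    · simp [Test.Ok, tmp, e36, hdlt.trans hbase, hc.trans hbase]
    · intro h
      simp [Test.natEval, e36] at h
      refine Run.assign_last (by norm_num) (by simp) ?_ ⟨⟨?_, ?_⟩, ?_⟩
      · simp [e44, e17, h1, c3, c4, code_lt hM]
      · simp [e43]
      · simp [e44, e17, h1, c4, Index.psum_succ, h]
      · intro k hk
        simp [show k ≠ 44 by omega, show k ≠ 46 by omega, hτ k (by omega)]
    · intro h
      simp [Test.natEval, e36] at h
      refine Run.skip (by simp) ⟨⟨?_, ?_⟩, ?_⟩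
      · simp [e43]
      · simp [e44, Index.psum_succ, h.not_gt]
      · intro k hk
        simp [show k ≠ 46 by omega, hτ k (by omega)]
  · rintro τ' ⟨⟨k1, k2⟩, k3⟩
    refine Run.assign_last (by norm_num) (by simp) (by simp) ⟨⟨?_, ?_⟩, ?_⟩
    · simp [k1]
    · simp [k2]
    · intro k hk
      simp [show k ≠ 43 by omega, k3 k hk]

theorem run_scan (hD : D.Valid) (hM : D.Stored code (2 ^ w) (cell m)) {l d n j c : ℕ}
    (hl : l < D.level) (hd : D.depth l ≤ d) (hσ : D.Loaded (cell m) σ) (h32 : σ 32 = l)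
    (h33 : σ 33 = D.base ^ l) (h36 : σ 36 = c) (hc : c < D.base) (h40 : σ 40 = n) (h43 : σ 43 = j)
    (hj : j ≤ n) (hn : n ≤ D.size) (h44 : σ 44 = code (D.psum l c j)) :
    Run w m code (.loop (.lt 43 40) scanStep) σ ((n - j) * (d * 101 + 101) + 1) fun σ' =>
      σ' 44 = code (D.psum l c n) ∧ ∀ k < 43, σ' k = σ k := by
  have hhalf := hM.half_lt
  let I : ℕ → (ℕ → ℕ) → Prop := fun b τ => (τ 43 + b = n ∧ τ 44 = code (D.psum l c (τ 43))) ∧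
    ∀ k < 43, τ k = σ k
  refine (Run.loop (T := d * 101 + 100) I ?_ ?_ (n - j) ?_).mono le_rfl ?_
  · rintro b τ ⟨⟨h1, h2⟩, h3⟩
    have := h3 40 (by norm_num)
    simp [Test.Ok, tmp, this, h40]
    omega
  · rintro b τ ⟨⟨h1, h2⟩, h5⟩ hlt
    simp only [Test.natEval, h5 40 (by norm_num), h40] at hlt
    refine (run_scanStep hD hM hl hd (hσ.of_agree fun k hk => h5 k (by omega)) ?_ ?_ ?_ hc rfl
      (by omega) h2).mono le_rfl ?_
    · rw [h5 _ (by norm_num), h32]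
    · rw [h5 _ (by norm_num), h33]
    · rw [h5 _ (by norm_num), h36]
    · rintro τ' ⟨⟨k1, k2⟩, k4⟩
      exact ⟨b - 1, by omega, ⟨by omega, by rw [k1, k2]⟩, fun k hk => (k4 k hk).trans (h5 k hk)⟩
  · exact ⟨⟨by omega, by rw [h43, h44]⟩, fun _ _ => rfl⟩
  · rintro τ ⟨h1, b, -, ⟨h2, h3⟩, h5⟩
    refine ⟨?_, h5⟩
    simp only [Test.natEval, h5 40 (by norm_num), h40] at h1
    rw [h3, show τ 43 = n by omega]

end Correctness

section Correctness

variable {G : Type*} [AddCommGroup G] {D : Index G} {N w : ℕ} {code : G ≃ Fin N} {m : List ℕ}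
  {σ : ℕ → ℕ}

/-- The points with key below the target are the first `cnt` of the level, so the condition on the
key becomes a bound on the position. -/
theorem Index.psum_eq_levelSum {l x y c cnt : ℕ} (hc : D.digit l x = c) (hcs : cnt ≤ D.size)
    (hcnt : ∀ i < D.size, D.key l (D.last l i) < x % D.base ^ l * (D.size * D.size) + y ↔ i < cnt) :
    D.psum l c cnt = D.levelSum x y l := by
  unfold Index.psum Index.levelSum
  rw [← Finset.sum_subset (Finset.range_subset_range.2 hcs)]
  · refine Finset.sum_congr rfl fun i hi => ?_
    have hi := Finset.mem_range.1 hi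
    simp [hc, (hcnt i (hi.trans_le hcs)).2 hi]
  · intro i hi hi'
    rw [Finset.mem_range] at hi hi'
    simp [hcnt i hi, hi']

/-- Bound for the number of steps on one level. -/
def Index.levelTime (D : Index G) (d : ℕ) : ℕ :=
  (D.bits + 1) * (d * 101 + 101) + D.block * (d * 101 + 101) + 200

/-- By sortedness the points below the target key form a prefix. Binary search finds its length, the
sample at the last block boundary gives most of its sum, and a scan adds the rest. -/
theorem run_levelProg (hD : D.Valid) (hM : D.Stored code (2 ^ w) (cell m)) {l d x y : ℕ} {g : G}
    (hl : l < D.level) (hd : D.depth l ≤ d) (hσ : D.Loaded (cell m) σ) (h30 : σ 30 = x)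
    (hx : x < D.base ^ D.level) (h31 : σ 31 = y) (hy : y ≤ D.size * D.size) (h32 : σ 32 = l)
    (h33 : σ 33 = D.base ^ l) (h34 : σ 34 = code g) :
    Run w m code levelProg σ (D.levelTime d) fun σ' =>
      (σ' 32 = l + 1 ∧ σ' 33 = D.base ^ (l + 1) ∧ σ' 34 = code (g + D.levelSum x y l)) ∧
      ∀ k < 32, σ' k = σ k := by
  have hpl := hD.pow_lt hM hl.le
  have hxW := hx.trans hM.pow_lt
  have hbase := hM.base_lt
  have hhalf := hM.half_lt
  have hdig : x / D.base ^ l % D.base = D.digit l x := rfl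
  have hdlt : D.digit l x < D.base := Nat.mod_lt _ hD.base_pos
  obtain ⟨t, ht⟩ : ∃ t, t = x % D.base ^ l * (D.size * D.size) + y := ⟨_, rfl⟩
  have htW : t < 2 ^ w := by
    refine lt_of_le_of_lt ?_ hM.key_lt
    rw [ht]
    calc _ ≤ x % D.base ^ l * (D.size * D.size) + 1 * (D.size * D.size) := by omega
      _ = (x % D.base ^ l + 1) * (D.size * D.size) := by ring
      _ ≤ _ := Nat.mul_le_mul_right _ ((Nat.mod_lt _ (pow_pos hD.base_pos _)).trans_le
          (Nat.pow_le_pow_right hD.base_pos hl.le))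
  obtain ⟨cnt, hcs, hcnt⟩ := exists_threshold (fun i => D.key l (D.last l i) < t) D.size
    fun i j hij hj h => (hD.sorted l hl i j hij hj).trans_lt h
  obtain ⟨A, hA⟩ : ∃ A, A = (D.bits + 1) * (d * 101 + 101) := ⟨_, rfl⟩
  obtain ⟨B, hB⟩ : ∃ B, B = D.block * (d * 101 + 101) := ⟨_, rfl⟩
  have hT : D.levelTime d = A + B + 200 := by rw [hA, hB]; rfl
  rw [hT]
  refine Run.assign_seq (by norm_num) (by simp) ?_ ?_
  · simp [h30, h33, hxW, hpl]
  refine Run.assign_seq (by norm_num) (by simp) ?_ ?_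
  · simp [h30, h33, hσ.base, hxW, hpl, hbase, (Nat.div_le_self _ _).trans_lt hxW]
  refine Run.assign_seq (by norm_num) (by simp) (by simp) ?_
  refine Run.assign_seq (by norm_num) (by simp) (by simp) ?_
  refine Run.seq_sub (A + 1) (by simp; omega) ?_
  rw [hA]
  refine (run_search hD hM (t := t) hl hd (hσ.of_agree fun k hk => ?_) ?_ ?_ ?_ htW hcnt hcs ?_
    ?_).mono le_rfl ?_
  · simp [show k ≠ 35 by omega, show k ≠ 36 by omega, show k ≠ 40 by omega, show k ≠ 41 by omega]
  · simp [h32]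
  · simp [h33]
  · simp [ht, h30, h31, h33, hσ.size_sq]
  · simp
  · simp [hσ.half]
  rintro τ ⟨h1, h2⟩
  have hτ : ∀ k < 35, τ k = σ k := by
    intro k hk
    rw [h2 k (by omega)]
    simp [show k ≠ 35 by omega, show k ≠ 36 by omega, show k ≠ 40 by omega, show k ≠ 41 by omega]
  have e36 : τ 36 = D.digit l x := by
    rw [h2 _ (by norm_num)]
    simp [h30, h33, hσ.base, hdig]
  have hτL := hσ.of_agree fun k hk => hτ k (by omega)
  have e11 := hτL.base
  have e19 := hτL.sample
  have e20 := hτL.blocks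
  have e21 := hτL.block
  have e32 := (hτ 32 (by norm_num)).trans h32
  have e33 := (hτ 33 (by norm_num)).trans h33
  have e34 := (hτ 34 (by norm_num)).trans h34
  have hcW : cnt < 2 ^ w := by omega
  have hbl := Nat.div_mul_le_self cnt D.block
  obtain ⟨s1, s2⟩ := hM.sample l hl (cnt / D.block) (hbl.trans hcs) _ hdlt
  rw [hD.sample_eq l hl _ (hbl.trans hcs) _ hdlt] at s2
  rw [← hA]
  refine Run.assign_seq (by norm_num) (by simp; omega) ?_ ?_
  · simp [h1, e21, hM.block_lt, hcW]
  refine Run.assign_seq (by norm_num) (by simp; omega) ?_ ?_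
  · simp [h1, e19, e32, e20, e21, e36, e11, hM.block_lt, hcW, s1]
  simp only [eval_add, eval_mul, eval_div, eval_load, eval_reg, ne_eq, Nat.reduceEqDiff,
    not_false_eq_true, Function.update_of_ne, h1, e19, e32, e20, e21, e36, e11, s2]
  refine Run.seq_sub (B + 1) (by simp; omega) ?_
  refine (run_scan hD hM (c := D.digit l x) (n := cnt) (j := cnt / D.block * D.block) hl hd
    (hτL.of_agree fun k hk => ?_) ?_ ?_ ?_ hdlt ?_ ?_ hbl hcs ?_).mono ?_ ?_
  · simp [show k ≠ 43 by omega, show k ≠ 44 by omega]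
  · simp [e32]
  · simp [e33]
  · simp [e36]
  · simp [h1]
  · simp
  · simp
  · rw [hB]
    gcongr
    -- The scan covers `cnt % D.block` points, fewer than one block.
    have := Nat.mod_lt cnt hD.block_pos
    have := Nat.div_add_mod' cnt D.block
    omega
  rintro υ ⟨k1, k2⟩
  have hυ : ∀ k < 35, υ k = σ k := by
    intro k hk
    rw [k2 k (by omega)]
    simp [show k ≠ 43 by omega, show k ≠ 44 by omega, hτ k hk]
  have f11 := (hυ 11 (by norm_num)).trans hσ.base
  have f32 := (hυ 32 (by norm_num)).trans h32
  have f33 := (hυ 33 (by norm_num)).trans h33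
  have f34 := (hυ 34 (by norm_num)).trans h34
  refine Run.assign_seq (by norm_num) (by simp; omega) ?_ ?_
  · simp [f34, k1, code_lt hM]
  refine Run.assign_seq (by norm_num) (by simp; omega) (by simp) ?_
  refine Run.assign_last (by norm_num) (by simp; omega) (by simp) ⟨⟨?_, ?_, ?_⟩, ?_⟩
  · simp [f32]
  · simp [f33, f11, pow_succ]
  · simp only [ne_eq, Nat.reduceEqDiff, not_false_eq_true, Function.update_of_ne,
      Function.update_self, eval_gadd, eval_reg, f34, k1, decodeNat_code]
    rw [Index.psum_eq_levelSum rfl hcs (by rw [← ht]; exact hcnt)]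
  · intro k hk
    simp [show k ≠ 32 by omega, show k ≠ 33 by omega, show k ≠ 34 by omega, hυ k (by omega)]

/-- Sum of the contributions of all levels for a corner. -/
def Index.cornerSum (D : Index G) (x y : ℕ) : G :=
  ∑ l ∈ Finset.range D.level, D.levelSum x y l

/-- Bound for the number of steps for one corner. -/
def Index.cornerTime (D : Index G) (d : ℕ) : ℕ := D.level * (D.levelTime d + 1) + 100

/-- The expressions are evaluated at different moments, the second after register 30 has been
written. Their values are therefore prescribed for every state that agrees with `σ` below register
30. -/
theorem run_cornerProg (hD : D.Valid) (hM : D.Stored code (2 ^ w) (cell m)) {d X Y : ℕ}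
    {eX eY : Expr} (hd : ∀ l < D.level, D.depth l ≤ d) (hσ : D.Loaded (cell m) σ)
    (hX : X ≤ D.size) (hY : Y ≤ D.size)
    (hXc : eX.cost ≤ 5) (hYc : eY.cost ≤ 5)
    (hXo : ∀ τ, eX.Ok (2 ^ w) (cell m) code τ) (hYo : ∀ τ, eY.Ok (2 ^ w) (cell m) code τ)
    (hXe : ∀ τ : ℕ → ℕ, (∀ k < 30, τ k = σ k) → eX.eval (cell m) code τ = X)
    (hYe : ∀ τ : ℕ → ℕ, (∀ k < 30, τ k = σ k) → eY.eval (cell m) code τ = Y) :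
    Run w m code (cornerProg eX eY) σ (D.cornerTime d) fun σ' =>
      σ' 34 = code (D.cornerSum (D.rev X) (Y * D.size)) ∧ ∀ k < 30, σ' k = σ k := by
  obtain ⟨r1, r2⟩ := hM.rev X hX
  have hlev := hM.level_lt
  obtain ⟨A, hA⟩ : ∃ A, A = D.level * (D.levelTime d + 1) := ⟨_, rfl⟩
  have hT : D.cornerTime d = A + 100 := by rw [hA]; rfl
  rw [hT]
  refine Run.assign_seq (by norm_num) (by simp; omega) ?_ ?_
  · simp [hXo, hXe σ fun _ _ => rfl, hσ.rev, r1]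
  refine Run.assign_seq (by norm_num) (by simp; omega) (by simp [hYo]) ?_
  refine Run.assign_seq (by norm_num) (by simp; omega) (by simp) ?_
  refine Run.assign_seq (by norm_num) (by simp; omega) (by simp) ?_
  refine Run.assign_seq (by norm_num) (by simp; omega) (by simp) ?_
  have hY2 : ∀ v, eY.eval (cell m) code (Function.update σ 30 v) = Y := by
    intro v
    refine hYe _ fun k hk => ?_
    simp [show k ≠ 30 by omega]
  simp only [eval_add, eval_mul, eval_load, eval_reg, hσ.rev, hXe σ fun _ _ => rfl, r2, hY2,
    eval_gzero, ne_eq, Nat.reduceEqDiff, not_false_eq_true, Function.update_of_ne, hσ.size,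
    eval_ofNat]
  let I : ℕ → (ℕ → ℕ) → Prop := fun n τ => (τ 32 + n = D.level ∧ τ 33 = D.base ^ τ 32 ∧
    τ 34 = code (∑ l ∈ Finset.range (τ 32), D.levelSum (D.rev X) (Y * D.size) l)) ∧
    (τ 30 = D.rev X ∧ τ 31 = Y * D.size) ∧ ∀ k < 30, τ k = σ k
  refine (Run.loop (T := D.levelTime d) I ?_ ?_ D.level ?_).mono ?_ ?_
  · rintro n τ ⟨⟨h1, -, -⟩, -, h3⟩
    have := h3 10 (by norm_num)
    simp [Test.Ok, tmp, this, hσ.level]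
    omega
  · rintro n τ ⟨⟨h1, h2, h3⟩, ⟨h4, h5⟩, h6⟩ hlt
    simp only [Test.natEval, h6 10 (by norm_num), hσ.level] at hlt
    refine (run_levelProg hD hM hlt (hd _ hlt) (hσ.of_agree h6) h4 (hD.rev_lt X hX) h5
      (Nat.mul_le_mul_right _ hY) rfl h2 h3).mono le_rfl ?_
    rintro τ' ⟨⟨k1, k2, k3⟩, k4⟩
    refine ⟨n - 1, by omega, ⟨by omega, by rw [k1, k2], ?_⟩,
      ⟨(k4 _ (by norm_num)).trans h4, (k4 _ (by norm_num)).trans h5⟩,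
      fun k hk => (k4 k (by omega)).trans (h6 k hk)⟩
    rw [k1, k3, Finset.sum_range_succ]
  · refine ⟨⟨by simp, by simp, by simp⟩, ⟨by simp, by simp⟩, fun k hk => ?_⟩
    simp [show k ≠ 30 by omega, show k ≠ 31 by omega, show k ≠ 32 by omega,
      show k ≠ 33 by omega, show k ≠ 34 by omega]
  · simp
    omega
  · rintro τ ⟨h1, n, -, ⟨h2, -, h3⟩, -, h4⟩
    refine ⟨?_, h4⟩
    simp only [Test.natEval, h4 10 (by norm_num), hσ.level] at h1
    rw [h3, show τ 32 = D.level by omega]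
    rfl

theorem run_setupProg (hM : D.Stored code (2 ^ w) (cell m)) :
    Run w m code setupProg σ 100 fun σ' => D.Loaded (cell m) σ' ∧ ∀ k < 10, σ' k = σ k := by
  have hc := hM.const_lt
  have b : ∀ n ≤ 10, n < 2 ^ w := fun n hn => by omega
  iterate 12 refine Run.assign_seq (by norm_num) (by simp) (by simp [b]) ?_
  refine Run.assign_last (by norm_num) (by simp) (by simp) ⟨?_, ?_⟩
  · constructor <;> simp [hM.level_eq, hM.base_eq, hM.size_eq, hM.half_eq, hM.blocks_eq,
      hM.block_eq]
  · intro k hk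
    have : ∀ j, 10 ≤ j → k ≠ j := fun j hj => by omega
    simp [this]

/-- One statement serves all four corners; the alternative `he` selects whether the corner enters
with plus or minus. -/
theorem run_cornerProg_acc (hD : D.Valid) (hM : D.Stored code (2 ^ w) (cell m)) {d X Y : ℕ}
    {eX eY e : Expr} {τ : ℕ → ℕ} {g g' : G} (hd : ∀ l < D.level, D.depth l ≤ d)
    (hτ : D.Loaded (cell m) τ) (hX : X ≤ D.size) (hY : Y ≤ D.size)
    (hXc : eX.cost ≤ 5) (hYc : eY.cost ≤ 5)
    (hXo : ∀ τ, eX.Ok (2 ^ w) (cell m) code τ) (hYo : ∀ τ, eY.Ok (2 ^ w) (cell m) code τ)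
    (hστ : ∀ k < 4, τ k = σ k) (h4 : τ 4 = code g)
    (hXe : ∀ τ : ℕ → ℕ, (∀ k < 4, τ k = σ k) → eX.eval (cell m) code τ = X)
    (hYe : ∀ τ : ℕ → ℕ, (∀ k < 4, τ k = σ k) → eY.eval (cell m) code τ = Y)
    (he : e = gadd (reg 4) (reg 34) ∧ g' = g + D.cornerSum (D.rev X) (Y * D.size) ∨
      e = gadd (reg 4) (gneg (reg 34)) ∧ g' = g - D.cornerSum (D.rev X) (Y * D.size)) :
    Run w m code (.seq (cornerProg eX eY) (assign 4 e)) τ (D.cornerTime d + 20) fun σ' =>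
      D.Loaded (cell m) σ' ∧ (∀ k < 4, σ' k = σ k) ∧ σ' 4 = code g' := by
  refine Run.seq_sub (D.cornerTime d) (by omega) ((run_cornerProg hD hM hd hτ hX hY hXc hYc hXo hYo
    (fun υ h => hXe υ fun k hk => (h k (by omega)).trans (hστ k hk))
    (fun υ h => hYe υ fun k hk => (h k (by omega)).trans (hστ k hk))).mono le_rfl ?_)
  rintro υ ⟨h1, h2⟩
  have e4 := (h2 4 (by norm_num)).trans h4
  rcases he with ⟨rfl, rfl⟩ | ⟨rfl, rfl⟩
  all_goals
    refine Run.assign_last (by norm_num) (by simp) (by simp [e4, h1, code_lt hM]) ⟨?_, ?_, ?_⟩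
    · have := hτ.of_agree h2
      constructor <;> simp [this.level, this.base, this.size, this.size_sq, this.half, this.col,
        this.row, this.val, this.rev, this.sample, this.blocks, this.block, this.zero]
    · intro k hk
      simp [show k ≠ 4 by omega, h2 k (by omega), hστ k hk]
    · simp [e4, h1, sub_eq_add_neg]

theorem run_queryProg (hD : D.Valid) (hM : D.Stored code (2 ^ w) (cell m)) {d x₁ x₂ y₁ y₂ : ℕ}
    (hd : ∀ l < D.level, D.depth l ≤ d)
    (hx₁ : x₁ < D.size) (hx₂ : x₂ < D.size) (hy₁ : y₁ < D.size) (hy₂ : y₂ < D.size)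
    (h0 : σ 0 = x₁) (h1 : σ 1 = x₂) (h2 : σ 2 = y₁) (h3 : σ 3 = y₂) :
    Run w m code queryProg σ (4 * D.cornerTime d + 300) fun σ' =>
      σ' 0 = code (if x₂ < x₁ ∨ y₂ < y₁ then 0 else
        D.cornerSum (D.rev (x₂ + 1)) ((y₂ + 1) * D.size)
        - D.cornerSum (D.rev (x₂ + 1)) (y₁ * D.size)
        - D.cornerSum (D.rev x₁) ((y₂ + 1) * D.size)
        + D.cornerSum (D.rev x₁) (y₁ * D.size)) := by
  have hhalf := hM.half_lt
  -- Empty rectangles are sorted out before, since inclusion-exclusion over the corners presupposes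
  -- `x₁ ≤ x₂` and `y₁ ≤ y₂`.
  refine Run.ite (by omega) (by simp only [Test.Ok, tmp]; omega) (fun hx => ?_) fun hx => ?_
  · simp only [Test.natEval, h0, h1] at hx
    exact Run.assign_last (by norm_num) (by simp) (by simp) (by simp [hx])
  refine Run.ite (by omega) (by simp only [Test.Ok, tmp]; omega) (fun hy => ?_) fun hy => ?_
  · simp only [Test.natEval, h2, h3] at hy
    exact Run.assign_last (by norm_num) (by simp) (by simp) (by simp [hy])
  simp only [Test.natEval, h0, h1, h2, h3] at hx hy
  obtain ⟨A, hA⟩ : ∃ A, A = D.cornerTime d := ⟨_, rfl⟩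
  rw [← hA]
  refine Run.seq_sub 100 (by omega) ((run_setupProg hM).mono le_rfl ?_)
  rintro τ ⟨hL, hτ⟩
  refine Run.assign_seq (by norm_num) (by simp) (by simp) ?_
  generalize hυ : Function.update τ 4 _ = υ
  have u4 : υ 4 = code 0 := by simp [← hυ]
  have uσ : ∀ k < 4, υ k = σ k := fun k hk => by
    simp [← hυ, show k ≠ 4 by omega, hτ k (by omega)]
  have uL : D.Loaded (cell m) υ := by
    rw [← hυ]
    constructor <;> simp [hL.level, hL.base, hL.size, hL.size_sq, hL.half, hL.col, hL.row, hL.val,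
      hL.rev, hL.sample, hL.blocks, hL.block, hL.zero]
  have e0 : ∀ τ : ℕ → ℕ, (∀ k < 4, τ k = σ k) → (reg 0).eval (cell m) code τ = x₁ :=
    fun τ h => (h 0 (by norm_num)).trans h0
  have e1 : ∀ τ : ℕ → ℕ, (∀ k < 4, τ k = σ k) → (reg 1 + 1).eval (cell m) code τ = x₂ + 1 :=
    fun τ h => by simp [h 1 (by norm_num), h1]
  have e2 : ∀ τ : ℕ → ℕ, (∀ k < 4, τ k = σ k) → (reg 2).eval (cell m) code τ = y₁ :=
    fun τ h => (h 2 (by norm_num)).trans h2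
  have e3 : ∀ τ : ℕ → ℕ, (∀ k < 4, τ k = σ k) → (reg 3 + 1).eval (cell m) code τ = y₂ + 1 :=
    fun τ h => by simp [h 3 (by norm_num), h3]
  refine Run.seq_sub (A + 20) (by simp; omega) ((run_cornerProg_acc hD hM hd uL hx₂ hy₂
    (by simp) (by simp) (by simp) (by simp) uσ u4 e1 e3 (.inl ⟨rfl, rfl⟩)).mono (by omega) ?_)
  rintro τ₁ ⟨L₁, f₁, g₁⟩
  refine Run.seq_sub (A + 20) (by simp; omega) ((run_cornerProg_acc hD hM hd L₁ hx₂ hy₁.le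
    (by simp) (by simp) (by simp) (by simp) f₁ g₁ e1 e2 (.inr ⟨rfl, rfl⟩)).mono (by omega) ?_)
  rintro τ₂ ⟨L₂, f₂, g₂⟩
  refine Run.seq_sub (A + 20) (by simp; omega) ((run_cornerProg_acc hD hM hd L₂ hx₁.le hy₂
    (by simp) (by simp) (by simp) (by simp) f₂ g₂ e0 e3 (.inr ⟨rfl, rfl⟩)).mono (by omega) ?_)
  rintro τ₃ ⟨L₃, f₃, g₃⟩
  refine Run.seq_sub (A + 20) (by simp; omega) ((run_cornerProg_acc hD hM hd L₃ hx₁.le hy₁.le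
    (by simp) (by simp) (by simp) (by simp) f₃ g₃ e0 e2 (.inl ⟨rfl, rfl⟩)).mono (by omega) ?_)
  rintro τ₄ ⟨-, -, g₄⟩
  refine Run.assign_last (by norm_num) (by simp; omega) (by simp) ?_
  simp [g₄, hx, hy]

end Correctness
end WordRAM

/-! ### Ranks with respect to injective keys -/

section Rank

open Finset

variable {r : ℕ}

/-- Number of elements with a smaller key. -/
def keyRank (k : Fin r → ℕ) (q : Fin r) : ℕ := #{q' | k q' < k q}

variable {k : Fin r → ℕ}

theorem keyRank_lt (k : Fin r → ℕ) (q : Fin r) : keyRank k q < r := by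
  have h : ({q' | k q' < k q} : Finset (Fin r)) ⊂ univ :=
    (filter_ssubset).2 ⟨q, mem_univ _, lt_irrefl _⟩
  simpa [keyRank] using card_lt_card h

theorem keyRank_lt_keyRank {q q' : Fin r} : keyRank k q < keyRank k q' ↔ k q < k q' := by
  have mono : ∀ a b : Fin r, k a ≤ k b → keyRank k a ≤ keyRank k b := fun a b h =>
    card_le_card fun x hx => by
      simp only [mem_filter, mem_univ, true_and] at hx ⊢
      omega
  refine ⟨fun h => lt_of_not_ge fun h' => (mono _ _ h').not_gt h, fun h => card_lt_card ?_⟩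
  refine ssubset_iff_of_subset (fun x hx => ?_) |>.2 ⟨q, ?_, ?_⟩
  · simp only [mem_filter, mem_univ, true_and] at hx ⊢
    omega
  · simpa using h
  · simp

theorem keyRank_bijective (hk : Function.Injective k) :
    Function.Bijective fun q => (⟨keyRank k q, keyRank_lt k q⟩ : Fin r) := by
  refine Function.Injective.bijective_of_finite fun a b h => hk ?_
  have h : keyRank k a = keyRank k b := by simpa using h
  have h1 := keyRank_lt_keyRank (k := k) (q := a) (q' := b)
  have h2 := keyRank_lt_keyRank (k := k) (q := b) (q' := a)
  omega

/-- The enumeration of the elements by increasing key. -/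
noncomputable def ranked (hk : Function.Injective k) : Fin r ≃ Fin r :=
  (Equiv.ofBijective _ (keyRank_bijective hk)).symm

theorem keyRank_ranked (hk : Function.Injective k) (i : Fin r) :
    keyRank k (ranked hk i) = i := by
  exact congrArg Fin.val ((Equiv.ofBijective _ (keyRank_bijective hk)).apply_symm_apply i)

theorem ranked_eq (hk : Function.Injective k) (q : Fin r) :
    ranked hk ⟨keyRank k q, keyRank_lt k q⟩ = q :=
  (Equiv.ofBijective _ (keyRank_bijective hk)).symm_apply_apply q

theorem key_ranked_lt (hk : Function.Injective k) {i j : Fin r} :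
    k (ranked hk i) < k (ranked hk j) ↔ i < j := by
  rw [← keyRank_lt_keyRank, keyRank_ranked, keyRank_ranked, Fin.lt_def]

/-- If `k'` orders by `c` first and by `k` second, then the rank for `k'` is the sum of a number
that depends on `c` and on the block of the rank for `k`, and of a rank in this block. -/
theorem keyRank_lex {k' c : Fin r → ℕ}
    (h : ∀ q q', k' q' < k' q ↔ c q' < c q ∨ c q' = c q ∧ k q' < k q) {B : ℕ} (q : Fin r) :
    keyRank k' q = #{q' | c q' < c q ∨ c q' = c q ∧ keyRank k q' < keyRank k q / B * B} +
      #{q' | c q' = c q ∧ keyRank k q / B * B ≤ keyRank k q' ∧ keyRank k q' < keyRank k q} := by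
  have hB := Nat.div_mul_le_self (keyRank k q) B
  unfold keyRank at hB ⊢
  -- Of the predecessors of `q` for `k'`, the second set takes those with equal `c` in the same
  -- block of `k`-ranks, the first set all others.
  rw [← card_union_of_disjoint]
  · congr 1
    ext x
    simp only [mem_filter, mem_univ, true_and, mem_union, h]
    have := keyRank_lt_keyRank (k := k) (q := x) (q' := q)
    unfold keyRank at this
    rw [← this]
    omega
  · rw [disjoint_filter]
    intro x _ h1
    omega

/-- Ranks embed the set into the interval from the start of the block to the rank of `q`, which is
shorter than a block. -/
theorem card_block_lt (hk : Function.Injective k) {B : ℕ} (hB : 0 < B) (c : Fin r → ℕ)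
    (q : Fin r) :
    #{q' | c q' = c q ∧ keyRank k q / B * B ≤ keyRank k q' ∧ keyRank k q' < keyRank k q} < B := by
  have h1 : #{q' | c q' = c q ∧ keyRank k q / B * B ≤ keyRank k q' ∧ keyRank k q' < keyRank k q}
      ≤ #(Finset.Ico (keyRank k q / B * B) (keyRank k q)) := by
    refine card_le_card_of_injOn (keyRank k) (fun x hx => ?_) (fun x _ y _ hxy => ?_)
    · simp only [coe_filter, mem_univ, true_and, Set.mem_ofPred_eq] at hx
      simp [hx.2]
    · apply (keyRank_bijective hk).1
      simpa using hxy
  rw [Nat.card_Ico] at h1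
  have := Nat.div_add_mod' (keyRank k q) B
  have := Nat.mod_lt (keyRank k q) hB
  omega

end Rank

/-! ### Digit reversal and comparison by the highest differing digit -/

section Reversal

open Finset

/-- Reversal of the `h` lowest digits in base `Q`. -/
def digitRev (Q : ℕ) : ℕ → ℕ → ℕ
  | 0, _ => 0
  | h + 1, x => x / Q ^ h + Q * digitRev Q h (x % Q ^ h)

variable {Q : ℕ}

theorem digitRev_lt (hQ : 0 < Q) (h x : ℕ) (hx : x < Q ^ h) : digitRev Q h x < Q ^ h := by
  induction h generalizing x with
  | zero => simp [digitRev]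
  | succ h ih =>
    have h1 := ih (x % Q ^ h) (Nat.mod_lt _ (by positivity))
    have h2 : x / Q ^ h < Q := Nat.div_lt_of_lt_mul (by rwa [← pow_succ])
    rw [digitRev, pow_succ]
    nlinarith

/-- Exactly one digit, the highest one in which they differ, decides between two numbers. -/
theorem sum_digitRev {G : Type*} [AddCommMonoid G] (hQ : 0 < Q) (h x y : ℕ) (hx : x < Q ^ h)
    (hy : y < Q ^ h) (g : G) :
    ∑ l ∈ range h, (if digitRev Q h x % Q ^ l = digitRev Q h y % Q ^ l ∧
      digitRev Q h x / Q ^ l % Q < digitRev Q h y / Q ^ l % Q then g else 0) =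
      if x < y then g else 0 := by
  induction h generalizing x y with
  | zero => simp at hx hy; simp [hx, hy]
  | succ h ih =>
    have hp : 0 < Q ^ h := by positivity
    have dx : x / Q ^ h < Q := Nat.div_lt_of_lt_mul (by rwa [← pow_succ])
    have dy : y / Q ^ h < Q := Nat.div_lt_of_lt_mul (by rwa [← pow_succ])
    have mx := Nat.mod_lt x hp
    have my := Nat.mod_lt y hp
    have ex := Nat.div_add_mod x (Q ^ h)
    have ey := Nat.div_add_mod y (Q ^ h)
    specialize ih _ _ mx my
    -- The term `l = 0` compares the leading digits, which reversal has put lowest; the other terms,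
    -- shifted by one, concern the remaining `h` digits.
    rw [sum_range_succ']
    simp only [digitRev]
    obtain ⟨a, ha⟩ : ∃ a, x / Q ^ h = a := ⟨_, rfl⟩
    obtain ⟨b, hb⟩ : ∃ b, y / Q ^ h = b := ⟨_, rfl⟩
    obtain ⟨x', hx'⟩ : ∃ x', x % Q ^ h = x' := ⟨_, rfl⟩
    obtain ⟨y', hy'⟩ : ∃ y', y % Q ^ h = y' := ⟨_, rfl⟩
    simp only [ha, hb, hx', hy'] at dx dy mx my ex ey ih ⊢
    have hmod : ∀ c < Q, ∀ z l, (c + Q * z) % Q ^ (l + 1) = c + Q * (z % Q ^ l) := by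
      intro c hc z l
      rw [pow_succ', Nat.mod_mul, Nat.add_mul_mod_self_left, Nat.mod_eq_of_lt hc,
        Nat.add_mul_div_left _ _ hQ, Nat.div_eq_of_lt hc, zero_add]
    have hdiv : ∀ c < Q, ∀ z l, (c + Q * z) / Q ^ (l + 1) = z / Q ^ l := by
      intro c hc z l
      rw [pow_succ', ← Nat.div_div_eq_div_mul, Nat.add_mul_div_left _ _ hQ, Nat.div_eq_of_lt hc,
        zero_add]
    have heq : ∀ u v : ℕ, a + Q * u = b + Q * v ↔ a = b ∧ u = v := by
      intro u v
      refine ⟨fun e => ?_, fun ⟨e1, e2⟩ => by rw [e1, e2]⟩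
      have e1 := congrArg (· % Q) e
      simp only [Nat.add_mul_mod_self_left, Nat.mod_eq_of_lt dx, Nat.mod_eq_of_lt dy] at e1
      subst e1
      exact ⟨rfl, Nat.eq_of_mul_eq_mul_left hQ (by omega)⟩
    simp only [hmod a dx, hmod b dy, hdiv a dx, hdiv b dy, heq, pow_zero, Nat.mod_one, Nat.div_one,
      Nat.add_mul_mod_self_left, Nat.mod_eq_of_lt dx, Nat.mod_eq_of_lt dy, true_and]
    -- If the leading digits differ, all later terms vanish and the first decides; if they agree,
    -- the first vanishes and the induction hypothesis applies.
    rcases lt_trichotomy a b with hab | rfl | hab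
    · have : x < y := by
        have : Q ^ h * (a + 1) ≤ Q ^ h * b := Nat.mul_le_mul_left _ hab
        rw [mul_add] at this
        omega
      simp [hab, hab.ne, this]
    · have : x < y ↔ x' < y' := by omega
      simp only [true_and, lt_irrefl, if_false, add_zero, this]
      exact ih
    · have : ¬ x < y := by
        have : Q ^ h * (b + 1) ≤ Q ^ h * a := Nat.mul_le_mul_left _ hab
        rw [mul_add] at this
        omega
      simp [hab.not_gt, hab.ne', this]

end Reversal

/-! ### Packing numbers into words -/

section Packing

open Finset

theorem sum_pow_div_mod {b : ℕ} (hb : 0 < b) (g : ℕ → ℕ) (hg : ∀ u, g u < b) (n k : ℕ)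
    (hk : k < n) : (∑ u ∈ range n, g u * b ^ u) / b ^ k % b = g k := by
  induction n generalizing g k with
  | zero => omega
  | succ n ih =>
    have e : ∑ u ∈ range (n + 1), g u * b ^ u = g 0 + b * ∑ u ∈ range n, g (u + 1) * b ^ u := by
      rw [sum_range_succ', mul_sum, add_comm]
      congr 1
      · simp
      · exact sum_congr rfl fun u _ => by ring
    rw [e]
    obtain _ | k := k
    · simp [Nat.add_mul_mod_self_left, Nat.mod_eq_of_lt (hg 0)]
    · rw [pow_succ', ← Nat.div_div_eq_div_mul, Nat.add_mul_div_left _ _ hb,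
        Nat.div_eq_of_lt (hg 0), zero_add]
      exact ih (fun u => g (u + 1)) (fun u => hg _) k (by omega)

theorem sum_pow_lt {b : ℕ} (g : ℕ → ℕ) (hg : ∀ u, g u < b) (n : ℕ) :
    ∑ u ∈ range n, g u * b ^ u < b ^ n := by
  induction n with
  | zero => simp
  | succ n ih =>
    rw [sum_range_succ, pow_succ]
    have : (g n + 1) * b ^ n ≤ b * b ^ n := Nat.mul_le_mul_right _ (hg n)
    nlinarith

/-- The list of the values of a function at `0, …, n - 1`. -/
def tabulate (n : ℕ) (f : ℕ → ℕ) : List ℕ := (List.range n).map f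

@[simp] theorem tabulate_length (n : ℕ) (f : ℕ → ℕ) : (tabulate n f).length = n := by
  simp [tabulate]

theorem tabulate_getD {n i : ℕ} (hi : i < n) (f : ℕ → ℕ) : (tabulate n f).getD i 0 = f i := by
  simp [tabulate, List.getD_eq_getElem?_getD, hi]

theorem forall_mem_tabulate {n : ℕ} {f : ℕ → ℕ} {P : ℕ → Prop} :
    (∀ x ∈ tabulate n f, P x) ↔ ∀ i < n, P (f i) := by
  simp [tabulate]

end Packing

/-! ### Compressed tables for jumps between two orders -/

section JumpTable

open Finset

variable {r : ℕ}

/-- Extension of a function on `Fin r` by zero. -/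
def extendZero {α : Type*} [Zero α] (f : Fin r → α) (i : ℕ) : α :=
  if h : i < r then f ⟨i, h⟩ else 0

theorem extendZero_of_lt {α : Type*} [Zero α] (f : Fin r → α) {i : ℕ} (h : i < r) :
    extendZero f i = f ⟨i, h⟩ := dif_pos h

@[simp] theorem extendZero_fin {α : Type*} [Zero α] (f : Fin r → α) (i : Fin r) :
    extendZero f i = f i := dif_pos i.2

/-- Packed entries and base values from which the rank for one key can be computed from the rank
for another key. -/
structure JumpTable where
  perWord : ℕ
  width : ℕ
  block : ℕ
  symbols : ℕ
  items : List ℕ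
  bases : List ℕ

/-- The packed entry at position `i`. -/
def JumpTable.entry (J : JumpTable) (i : ℕ) : ℕ :=
  J.items.getD (i / J.perWord) 0 / 2 ^ (i % J.perWord * J.width) % 2 ^ J.width

/-- The table translates the rank `k` into the rank `k'`, with numbers of `lam` bits and words of
`4 * lam` bits. -/
structure JumpTable.Valid (J : JumpTable) (lam : ℕ) (k k' : Fin r → ℕ) : Prop where
  perWord_le : J.perWord ≤ 4 * lam
  width_le : J.width ≤ 2 * lam
  block_lt : J.block < 2 ^ lam
  symbols_lt : J.symbols < 2 ^ lam
  items_lt : ∀ x ∈ J.items, x < 2 ^ (4 * lam)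
  bases_lt : ∀ x ∈ J.bases, x < 2 ^ (4 * lam)
  index_lt : ∀ q, k q / J.perWord < J.items.length
  shift_le : ∀ q, k q % J.perWord * J.width ≤ 4 * lam
  base_lt : ∀ q, k q / J.block * J.symbols + J.entry (k q) / J.block < J.bases.length
  rank_eq : ∀ q, J.bases.getD (k q / J.block * J.symbols + J.entry (k q) / J.block) 0 +
    J.entry (k q) % J.block = k' q

/-- Entries of `width` bits, packed into words. -/
def packItems (lam r width : ℕ) (f : ℕ → ℕ) : List ℕ :=
  tabulate (r / (4 * lam / width) + 1) fun t =>
    ∑ u ∈ range (4 * lam / width), f (t * (4 * lam / width) + u) * (2 ^ width) ^ u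

variable {lam width : ℕ} {f : ℕ → ℕ}

theorem packItems_lt (hf : ∀ i, f i < 2 ^ width) :
    ∀ x ∈ packItems lam r width f, x < 2 ^ (4 * lam) := by
  rw [packItems, forall_mem_tabulate]
  intro i _
  refine (sum_pow_lt _ (fun u => hf _) _).trans_le ?_
  rw [← pow_mul]
  exact Nat.pow_le_pow_right (by norm_num) (Nat.mul_div_le _ _)

theorem packItems_entry (hf : ∀ i, f i < 2 ^ width) (hper : 0 < 4 * lam / width) {i : ℕ}
    (hi : i < r) :
    (packItems lam r width f).getD (i / (4 * lam / width)) 0 /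
      2 ^ (i % (4 * lam / width) * width) % 2 ^ width = f i := by
  have h1 : i / (4 * lam / width) < r / (4 * lam / width) + 1 :=
    Nat.lt_succ_of_le (Nat.div_le_div_right hi.le)
  rw [packItems, tabulate_getD h1, mul_comm (i % _), pow_mul,
    sum_pow_div_mod (by positivity) _ (fun u => hf _) _ _ (Nat.mod_lt _ hper),
    Nat.div_add_mod']

/-- As an entry has at most `2 * lam` bits, rounding down the number of entries per word still
leaves at least `lam` of its `4 * lam` bits in use. -/
theorem packItems_length (hw : 0 < width) (hwl : width ≤ 2 * lam) :
    lam * (packItems lam r width f).length ≤ r * width + lam := by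
  have h1 : 0 < 4 * lam / width := Nat.div_pos (by omega) hw
  have h2 : 4 * lam < width * (4 * lam / width + 1) := Nat.lt_mul_div_succ _ hw
  rw [packItems, tabulate_length, mul_add, mul_one]
  generalize 4 * lam / width = per at *
  have h3 : lam ≤ width * per := by nlinarith
  calc lam * (r / per) + lam ≤ width * per * (r / per) + lam := by gcongr
    _ = width * (per * (r / per)) + lam := by ring
    _ ≤ width * r + lam := by gcongr; exact Nat.mul_div_le _ _
    _ = _ := by ring

theorem packItems_shift_le (hper : 0 < 4 * lam / width) (i : ℕ) :
    i % (4 * lam / width) * width ≤ 4 * lam :=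
  (Nat.mul_le_mul_right _ (Nat.mod_lt _ hper).le).trans (Nat.div_mul_le_self _ _)

/-- With blocks of `B = 2 ^ (s + η)` ranks, an entry `c * B + ρ` holds the symbol and the rank
inside the block in `2 * s + η` bits, and `keyRank_lex` supplies the base value. There is one base
value per block and symbol, and `2 ^ s * 2 ^ η = B` bounds their number. If `B` reaches `2 ^ lam`,
storing the new rank itself is no more expensive. -/
theorem exists_jumpTable (hr : 2 ≤ r) (hlam : r < 2 ^ lam) (hlam' : 2 ^ lam ≤ 2 * r)
    {k k' c : Fin r → ℕ} (hk : Function.Injective k)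
    (h : ∀ q q', k' q' < k' q ↔ c q' < c q ∨ c q' = c q ∧ k q' < k q)
    {s η : ℕ} (hs : 0 < s) (hc : ∀ q, c q < 2 ^ s) :
    ∃ J : JumpTable, J.Valid lam (keyRank k) (keyRank k') ∧
      lam * J.items.length ≤ r * (2 * s + η) + lam ∧ 2 ^ η * J.bases.length ≤ 2 * r + 2 ^ η := by
  have hlam0 : 0 < lam := by
    rcases Nat.eq_zero_or_pos lam with rfl | h
    · simp at hlam; omega
    · exact h
  by_cases hmode : s + η < lam
  · let B := 2 ^ (s + η)
    have hB : 0 < B := by positivity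
    have hBr : B ≤ r := by
      have : 2 ^ (s + η + 1) ≤ 2 ^ lam := Nat.pow_le_pow_right (by norm_num) hmode
      rw [pow_succ] at this
      show 2 ^ (s + η) ≤ r
      omega
    let ρ : Fin r → ℕ := fun q => #{q' | c q' = c q ∧ keyRank k q / B * B ≤ keyRank k q' ∧
      keyRank k q' < keyRank k q}
    have hρ : ∀ q, ρ q < B := card_block_lt hk hB c
    let f : ℕ → ℕ := extendZero fun i => c (ranked hk i) * B + ρ (ranked hk i)
    have hf : ∀ i, f i < 2 ^ (2 * s + η) := by
      intro i
      simp only [f, extendZero]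
      split
      · have h1 := hc (ranked hk ⟨i, by assumption⟩)
        have h2 := hρ (ranked hk ⟨i, by assumption⟩)
        have h3 : 2 ^ (2 * s + η) = 2 ^ s * B := by rw [← pow_add]; congr 1; omega
        rw [h3]
        nlinarith
      · positivity
    have hper : 0 < 4 * lam / (2 * s + η) := Nat.div_pos (by omega) (by omega)
    -- A base cell `t` belongs to block `t / 2 ^ s` and symbol `t % 2 ^ s`.
    let J : JumpTable := ⟨4 * lam / (2 * s + η), 2 * s + η, B, 2 ^ s,
      packItems lam r (2 * s + η) f, tabulate ((r / B + 1) * 2 ^ s) fun t =>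
        #{q' | c q' < t % 2 ^ s ∨ c q' = t % 2 ^ s ∧ keyRank k q' < t / 2 ^ s * B}⟩
    have hentry : ∀ q, J.entry (keyRank k q) = c q * B + ρ q := by
      intro q
      refine (packItems_entry hf hper (keyRank_lt k q)).trans ?_
      simp only [f]
      rw [extendZero_of_lt _ (keyRank_lt k q), ranked_eq]
    have hdiv : ∀ q, J.entry (keyRank k q) / B = c q := by
      intro q
      rw [hentry, mul_comm, Nat.mul_add_div hB, Nat.div_eq_of_lt (hρ q), add_zero]
    have hmod : ∀ q, J.entry (keyRank k q) % B = ρ q := by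
      intro q
      rw [hentry, mul_comm, Nat.mul_add_mod, Nat.mod_eq_of_lt (hρ q)]
    have hidx : ∀ q, keyRank k q / B * 2 ^ s + c q < (r / B + 1) * 2 ^ s := by
      intro q
      have h1 : keyRank k q / B ≤ r / B := Nat.div_le_div_right (keyRank_lt k q).le
      have h2 := hc q
      nlinarith
    refine ⟨J, ⟨Nat.div_le_self _ _, ?_, ?_, ?_, packItems_lt hf, ?_, ?_,
      fun q => packItems_shift_le hper _, ?_, ?_⟩, packItems_length (by omega) (by omega), ?_⟩
    · show 2 * s + η ≤ _
      omega
    · exact Nat.pow_lt_pow_right (by norm_num) hmode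
    · exact Nat.pow_lt_pow_right (by norm_num) (by omega)
    · show ∀ x ∈ tabulate _ _, _
      rw [forall_mem_tabulate]
      intro t _
      refine (card_le_univ _).trans_lt ?_
      rw [Fintype.card_fin]
      exact hlam.trans_le (Nat.pow_le_pow_right (by norm_num) (by omega))
    · intro q
      show _ < (packItems _ _ _ _).length
      rw [packItems, tabulate_length]
      exact Nat.lt_succ_of_le (Nat.div_le_div_right (keyRank_lt k q).le)
    · intro q
      show keyRank k q / B * 2 ^ s + J.entry (keyRank k q) / B < (tabulate _ _).length
      rw [hdiv, tabulate_length]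
      exact hidx q
    · intro q
      show (tabulate _ _).getD (keyRank k q / B * 2 ^ s + J.entry (keyRank k q) / B) 0 +
        J.entry (keyRank k q) % B = _
      rw [hdiv, hmod, tabulate_getD (hidx q), keyRank_lex h (B := B)]
      have h1 : (keyRank k q / B * 2 ^ s + c q) % 2 ^ s = c q := by
        rw [mul_comm, Nat.mul_add_mod, Nat.mod_eq_of_lt (hc q)]
      have h2 : (keyRank k q / B * 2 ^ s + c q) / 2 ^ s = keyRank k q / B := by
        rw [mul_comm, Nat.mul_add_div (by positivity), Nat.div_eq_of_lt (hc q), add_zero]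
      simp only [h1, h2]
      rfl
    · show 2 ^ η * (tabulate _ _).length ≤ _
      rw [tabulate_length]
      calc 2 ^ η * ((r / B + 1) * 2 ^ s) = B * (r / B) + B := by
            simp only [B]; rw [pow_add]; ring
        _ ≤ r + r := by gcongr; exact Nat.mul_div_le _ _
        _ = 2 * r := (two_mul r).symm
        _ ≤ _ := Nat.le_add_right _ _
  · let f : ℕ → ℕ := extendZero fun i => keyRank k' (ranked hk i)
    have hf : ∀ i, f i < 2 ^ lam := by
      intro i
      simp only [f, extendZero]
      split
      · exact (keyRank_lt _ _).trans hlam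
      · positivity
    have hper : 0 < 4 * lam / lam := Nat.div_pos (by omega) (by omega)
    -- With block length `r` both quotients vanish and the remainder is the whole entry, so the
    -- single base value 0 makes the general decoding return the stored rank.
    let J : JumpTable := ⟨4 * lam / lam, lam, r, 1, packItems lam r lam f, [0]⟩
    have hentry : ∀ q, J.entry (keyRank k q) = keyRank k' q := by
      intro q
      refine (packItems_entry hf hper (keyRank_lt k q)).trans ?_
      simp only [f]
      rw [extendZero_of_lt _ (keyRank_lt k q), ranked_eq]
    have hlt := fun q => keyRank_lt k q
    have hlt' := fun q => keyRank_lt k' q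
    refine ⟨J, ⟨Nat.div_le_self _ _, ?_, hlam, ?_, packItems_lt hf, ?_, ?_,
      fun q => packItems_shift_le hper _, ?_, ?_⟩,
      (packItems_length (by omega) (by omega)).trans ?_, ?_⟩
    · show lam ≤ _
      omega
    · exact Nat.one_lt_two_pow (by omega)
    · simp [J]
    · intro q
      show _ < (packItems _ _ _ _).length
      rw [packItems, tabulate_length]
      exact Nat.lt_succ_of_le (Nat.div_le_div_right (hlt q).le)
    · intro q
      rw [hentry]
      simp [J, Nat.div_eq_of_lt (hlt q), Nat.div_eq_of_lt (hlt' q)]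
    · intro q
      rw [hentry]
      simp [J, Nat.div_eq_of_lt (hlt q), Nat.div_eq_of_lt (hlt' q), Nat.mod_eq_of_lt (hlt' q)]
    · gcongr
      omega
    · simp [J]

end JumpTable

/-! ### Jump lengths: few jumps, small total length -/

section Levels

open Finset

variable (Q h : ℕ)

/-- Length of the jump from a level: the largest power of `Q` that divides it. -/
noncomputable def jumpLength (l : ℕ) : ℕ := if l = 0 then 1 else Q ^ multiplicity Q l

/-- The level to which the jump from a level leads. -/
noncomputable def nextLevel (l : ℕ) : ℕ := min h (l + jumpLength Q l)

variable {Q h}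

theorem jumpLength_pos (hQ : 0 < Q) (l : ℕ) : 0 < jumpLength Q l := by
  unfold jumpLength
  split <;> positivity

theorem jumpLength_mul {j m : ℕ} (hm : ¬ Q ∣ m) (hQ : 0 < Q) : jumpLength Q (Q ^ j * m) = Q ^ j := by
  have hm0 : m ≠ 0 := fun h => hm (h ▸ dvd_zero _)
  have : Q ^ j * m ≠ 0 := by positivity
  rw [jumpLength, if_neg this, multiplicity_eq_of_dvd_of_not_dvd (dvd_mul_right _ _)]
  rwa [pow_succ, Nat.mul_dvd_mul_iff_left (by positivity)]

/-- Starting at a multiple of `Q ^ j`, jumps of length `Q ^ j` lead within `Q` steps to a multiple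
of `Q ^ (j + 1)` or to the end. A positive multiple of `Q ^ K` is already at least `h`. -/
theorem exists_iterate_nextLevel (hQ : 2 ≤ Q) {K : ℕ} (hK : h ≤ Q ^ K) (i : ℕ) (hi : i ≤ K) (l : ℕ)
    (hl : 0 < l) (hd : Q ^ (K - i) ∣ l) : ∃ n ≤ Q * i, h ≤ (nextLevel Q h)^[n] l := by
  induction i generalizing l with
  | zero =>
    exact ⟨0, by simp, hK.trans (Nat.le_of_dvd hl (by simpa using hd))⟩
  | succ i ih =>
    -- `e` bounds the jumps still needed at the present exponent: each one raises the digit of `l`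
    -- at this place by one, until it overflows.
    have key : ∀ e l, 0 < l → Q ^ (K - (i + 1)) ∣ l →
        (¬ Q ^ (K - i) ∣ l → Q ≤ l / Q ^ (K - (i + 1)) % Q + e) →
        ∃ n ≤ Q * i + e, h ≤ (nextLevel Q h)^[n] l := by
      intro e
      induction e with
      | zero =>
        intro l hl hd he
        by_cases hd' : Q ^ (K - i) ∣ l
        · exact ih (by omega) l hl hd'
        · have := Nat.mod_lt (l / Q ^ (K - (i + 1))) (show 0 < Q by omega)
          have := he hd'
          omega
      | succ e ihe =>
        intro l hl hd he
        by_cases hd' : Q ^ (K - i) ∣ l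
        · obtain ⟨n, hn, h'⟩ := ih (by omega) l hl hd'
          exact ⟨n, by omega, h'⟩
        · have he := he hd'
          have hp : 0 < Q ^ (K - (i + 1)) := by positivity
          obtain ⟨m, rfl⟩ := hd
          have ep : Q ^ (K - i) = Q ^ (K - (i + 1)) * Q := by
            rw [← pow_succ]; congr 1; omega
          have hm : ¬ Q ∣ m := fun h => hd' (by rw [ep]; exact Nat.mul_dvd_mul_left _ h)
          rw [Nat.mul_div_cancel_left _ hp] at he
          by_cases hle : h ≤ Q ^ (K - (i + 1)) * m + Q ^ (K - (i + 1))
          · exact ⟨1, by omega, by simp [nextLevel, jumpLength_mul hm (by omega : 0 < Q), hle]⟩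
          · have en : nextLevel Q h (Q ^ (K - (i + 1)) * m) = Q ^ (K - (i + 1)) * (m + 1) := by
              rw [nextLevel, jumpLength_mul hm (by omega), mul_add, mul_one]
              omega
            obtain ⟨n, hn, h'⟩ := ihe (Q ^ (K - (i + 1)) * (m + 1)) (by positivity)
              (dvd_mul_right _ _) (by
                intro hnd
                rw [Nat.mul_div_cancel_left _ hp]
                have h1 : ¬ Q ∣ m + 1 := fun h => hnd (by rw [ep]; exact Nat.mul_dvd_mul_left _ h)
                have h2 := Nat.mod_lt m (show 0 < Q by omega)
                have h3 : (m % Q + 1) % Q = (m + 1) % Q := Nat.mod_add_mod _ _ _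
                rw [Nat.dvd_iff_mod_eq_zero, ← h3] at h1
                rw [← h3]
                rcases Nat.lt_or_ge (m % Q + 1) Q with h4 | h4
                · rw [Nat.mod_eq_of_lt h4]
                  omega
                · rw [show m % Q + 1 = Q by omega] at h1
                  simp at h1)
            exact ⟨n + 1, by omega, by rwa [Function.iterate_succ_apply, en]⟩
    obtain ⟨n, hn, h'⟩ := key Q l hl hd (fun _ => by omega)
    exact ⟨n, by rw [mul_add]; omega, h'⟩

/-- Number of jumps from a level to the last one. -/
noncomputable def levelDepth (Q h l : ℕ) : ℕ := sInf {n | h ≤ (nextLevel Q h)^[n] l}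

/-- The additional jump is the one from level 0, which every power of `Q` divides and whose jump
length is therefore set to 1 by convention. -/
theorem exists_iterate_nextLevel_le (hQ : 2 ≤ Q) {K : ℕ} (hK : h ≤ Q ^ K) (l : ℕ) :
    ∃ n ≤ Q * K + 1, h ≤ (nextLevel Q h)^[n] l := by
  rcases Nat.eq_zero_or_pos l with rfl | hl
  · rcases Nat.eq_zero_or_pos h with rfl | hh
    · exact ⟨0, by simp, by simp⟩
    · obtain ⟨n, hn, h'⟩ := exists_iterate_nextLevel hQ hK K le_rfl (nextLevel Q h 0)
        (by simp [nextLevel, jumpLength]; omega) (by simp)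
      exact ⟨n + 1, by omega, h'⟩
  · obtain ⟨n, hn, h'⟩ := exists_iterate_nextLevel hQ hK K le_rfl l hl (by simp)
    exact ⟨n, by omega, h'⟩

theorem levelDepth_le (hQ : 2 ≤ Q) {K : ℕ} (hK : h ≤ Q ^ K) (l : ℕ) :
    levelDepth Q h l ≤ Q * K + 1 := by
  obtain ⟨n, hn, h'⟩ := exists_iterate_nextLevel_le hQ hK l
  exact (Nat.sInf_le (s := {n | h ≤ (nextLevel Q h)^[n] l}) h').trans hn

/-- The depth is a least number of iterations; it is attained because `h ≤ Q ^ h`, and `l < h`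
excludes the value 0, so one jump can be removed. -/
theorem levelDepth_nextLevel_lt (hQ : 2 ≤ Q) {l : ℕ} (hl : l < h) :
    levelDepth Q h (nextLevel Q h l) < levelDepth Q h l := by
  have hmem : levelDepth Q h l ∈ {n | h ≤ (nextLevel Q h)^[n] l} := by
    obtain ⟨n, -, h'⟩ := exists_iterate_nextLevel_le hQ (Nat.lt_pow_self hQ).le l
    exact Nat.sInf_mem ⟨n, h'⟩
  generalize levelDepth Q h l = d at hmem
  obtain _ | n := d
  · simp only [Set.mem_ofPred_eq, Function.iterate_zero, id] at hmem
    omega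
  · exact Nat.lt_succ_of_le (Nat.sInf_le hmem)

/-- For `l > 0` the jump length is at most the sum of all `Q ^ j` with `j < K` that divide `l`.
Exchanging the sums, each `j` contributes at most `h`, since at most `h / Q ^ j` levels are
divisible; level 0 adds 1. -/
theorem sum_jumpLength_le (hQ : 2 ≤ Q) {K : ℕ} (hK : h ≤ Q ^ K) :
    ∑ l ∈ range h, jumpLength Q l ≤ K * h + 1 := by
  have key : ∀ l < h, jumpLength Q l ≤ (∑ j ∈ range K, if l ≠ 0 ∧ Q ^ j ∣ l then Q ^ j else 0) +
      if l = 0 then 1 else 0 := by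
    intro l hl
    unfold jumpLength
    split_ifs with h0
    · simp
    · have hd : Q ^ multiplicity Q l ∣ l := pow_multiplicity_dvd _ _
      have hK' : multiplicity Q l < K :=
        (Nat.pow_lt_pow_iff_right (by omega)).1
          ((Nat.le_of_dvd (by omega) hd).trans_lt (hl.trans_le hK))
      rw [add_zero]
      refine le_trans ?_ (single_le_sum (fun _ _ => Nat.zero_le _) (mem_range.2 hK'))
      simp [h0, hd]
  refine (sum_le_sum fun l hl => key l (mem_range.1 hl)).trans ?_
  rw [sum_add_distrib, sum_comm]
  have h2 : ∑ l ∈ range h, (if l = 0 then 1 else 0) ≤ 1 := by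
    rw [← card_filter]
    exact card_le_one.2 fun a ha b hb => by
      rw [(mem_filter.1 ha).2, (mem_filter.1 hb).2]
  refine add_le_add ?_ h2
  calc _ ≤ ∑ j ∈ range K, h := sum_le_sum fun j _ => ?_
    _ = K * h := by simp
  rw [← sum_filter, sum_const, smul_eq_mul]
  have h1 : #{l ∈ range h | l ≠ 0 ∧ Q ^ j ∣ l} ≤ #{l ∈ Ioc 0 h | Q ^ j ∣ l} :=
    card_le_card fun x hx => by simp at hx ⊢; omega
  rw [Nat.Ioc_filter_dvd_card_eq_div] at h1
  exact (Nat.mul_le_mul_right _ h1).trans (Nat.div_mul_le_self _ _)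

end Levels

/-! ### Concatenation of memory segments -/

section Concat

open Finset

/-- Concatenation of the lists `seg 0, …, seg (n - 1)`. -/
def concat (seg : ℕ → List ℕ) : ℕ → List ℕ
  | 0 => []
  | n + 1 => concat seg n ++ seg n

theorem concat_length (seg : ℕ → List ℕ) (n : ℕ) :
    (concat seg n).length = ∑ i ∈ range n, (seg i).length := by
  induction n with
  | zero => rfl
  | succ n ih => rw [concat, List.length_append, ih, sum_range_succ]

theorem concat_getD (seg : ℕ → List ℕ) {n j t : ℕ} (hj : j < n) (ht : t < (seg j).length) :
    (concat seg j).length + t < (concat seg n).length ∧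
    (concat seg n).getD ((concat seg j).length + t) 0 = (seg j).getD t 0 := by
  induction n with
  | zero => omega
  | succ n ih =>
    rw [concat, List.length_append]
    rcases Nat.lt_succ_iff_lt_or_eq.1 hj with hj | rfl
    · obtain ⟨h1, h2⟩ := ih hj
      refine ⟨by omega, ?_⟩
      rw [List.getD_append _ _ _ _ h1, h2]
    · refine ⟨by omega, ?_⟩
      rw [List.getD_append_right _ _ _ _ (by omega), Nat.add_sub_cancel_left]

theorem forall_mem_concat {seg : ℕ → List ℕ} {n : ℕ} {P : ℕ → Prop}
    (h : ∀ i < n, ∀ x ∈ seg i, P x) : ∀ x ∈ concat seg n, P x := by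
  induction n with
  | zero => simp [concat]
  | succ n ih =>
    intro x hx
    rcases List.mem_append.1 hx with hx | hx
    · exact ih (fun i hi => h i (by omega)) x hx
    · exact h n (by omega) x hx

end Concat

/-! ### The index of a point set and the sums it yields -/

section PointIndex

open Finset

variable {r : ℕ} {G : Type*} [AddCommGroup G]

/-- Reversed column of a point. -/
def revCol (Q h : ℕ) (p : Fin r → Fin r × Fin r) (q : Fin r) : ℕ := digitRev Q h (p q).1

/-- Row of a point, made unique by its number. -/
def rowKey (p : Fin r → Fin r × Fin r) (q : Fin r) : ℕ := (p q).2 * r + q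

/-- Sort key of a point on a level. -/
def levelKey (Q h : ℕ) (p : Fin r → Fin r × Fin r) (l : ℕ) (q : Fin r) : ℕ :=
  revCol Q h p q % Q ^ l * (r * r) + rowKey p q

theorem rowKey_lt (p : Fin r → Fin r × Fin r) (q : Fin r) : rowKey p q < r * r := by
  have h1 : ((p q).2 + 1 : ℕ) * r ≤ r * r := Nat.mul_le_mul_right _ (p q).2.2
  have h2 := q.2
  rw [add_mul] at h1
  unfold rowKey
  omega

/-- The point number only breaks ties: it is below `r`, so comparison with a multiple of `r` depends
on the row alone. This is why row bounds are scaled by `r`. -/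
theorem rowKey_lt_iff (p : Fin r → Fin r × Fin r) (q : Fin r) (y : ℕ) :
    rowKey p q < y * r ↔ ((p q).2 : ℕ) < y := by
  have h2 := q.2
  unfold rowKey
  constructor
  · intro h
    exact lt_of_mul_lt_mul_right (a := r) (by omega) (Nat.zero_le _)
  · intro h
    have : ((p q).2 + 1 : ℕ) * r ≤ y * r := Nat.mul_le_mul_right _ h
    rw [add_mul] at this
    omega

theorem levelKey_injective (Q h : ℕ) (p : Fin r → Fin r × Fin r) (l : ℕ) :
    Function.Injective (levelKey Q h p l) := by
  intro q q' e
  have h1 := congrArg (· % (r * r)) e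
  simp only [levelKey, Nat.mul_add_mod_self_right, Nat.mod_eq_of_lt (rowKey_lt p _)] at h1
  have h2 := congrArg (· % r) h1
  simp only [rowKey, Nat.mul_add_mod_self_right, Nat.mod_eq_of_lt q.2, Nat.mod_eq_of_lt q'.2] at h2
  exact Fin.ext h2

theorem mul_add_lt_mul_add_iff {c c' k k' M : ℕ} (hk : k < M) (hk' : k' < M) :
    c * M + k < c' * M + k' ↔ c < c' ∨ c = c' ∧ k < k' := by
  rcases lt_trichotomy c c' with h | rfl | h
  · have : (c + 1) * M ≤ c' * M := Nat.mul_le_mul_right _ h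
    rw [add_mul] at this
    exact ⟨fun _ => .inl h, fun _ => by omega⟩
  · simp
  · have : (c' + 1) * M ≤ c * M := Nat.mul_le_mul_right _ h
    rw [add_mul] at this
    exact ⟨fun _ => by omega, fun _ => by omega⟩

/-- The digits between two levels. -/
def levelSymbol (Q h : ℕ) (p : Fin r → Fin r × Fin r) (l n : ℕ) (q : Fin r) : ℕ :=
  revCol Q h p q / Q ^ l % Q ^ n

theorem levelKey_add (Q h : ℕ) (p : Fin r → Fin r × Fin r) (l n : ℕ) (q : Fin r) :
    levelKey Q h p (l + n) q =
      levelSymbol Q h p l n q * (Q ^ l * (r * r)) + levelKey Q h p l q := by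
  unfold levelKey levelSymbol
  rw [pow_add, Nat.mod_mul]
  ring

theorem levelKey_lt {Q : ℕ} (hQ : 0 < Q) (h : ℕ) (p : Fin r → Fin r × Fin r) (l : ℕ) (q : Fin r) :
    levelKey Q h p l q < Q ^ l * (r * r) := by
  have h1 : revCol Q h p q % Q ^ l < Q ^ l := Nat.mod_lt _ (by positivity)
  have h2 := rowKey_lt p q
  have h3 : (revCol Q h p q % Q ^ l + 1) * (r * r) ≤ Q ^ l * (r * r) := Nat.mul_le_mul_right _ h1
  rw [add_mul] at h3
  unfold levelKey
  omega

/-- The order of level `l + n` is the stable sort of the order of level `l` by the next `n` digits,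
the form required by `keyRank_lex`. -/
theorem levelKey_lex {Q : ℕ} (hQ : 0 < Q) (h : ℕ) (p : Fin r → Fin r × Fin r) (l n : ℕ)
    (q q' : Fin r) : levelKey Q h p (l + n) q' < levelKey Q h p (l + n) q ↔
      levelSymbol Q h p l n q' < levelSymbol Q h p l n q ∨
      levelSymbol Q h p l n q' = levelSymbol Q h p l n q ∧
        levelKey Q h p l q' < levelKey Q h p l q := by
  rw [levelKey_add, levelKey_add,
    mul_add_lt_mul_add_iff (levelKey_lt hQ h p l q') (levelKey_lt hQ h p l q)]

/-- The points in the order of a level. -/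
noncomputable def levelOrder (Q h : ℕ) (p : Fin r → Fin r × Fin r) (l : ℕ) : Fin r ≃ Fin r :=
  ranked (levelKey_injective Q h p l)

/-- The index without its sampled sums. -/
noncomputable def preIndex (Q h b : ℕ) (p : Fin r → Fin r × Fin r) (v : Fin r → G) :
    WordRAM.Index G where
  level := h
  base := Q
  size := r
  half := 2 ^ b
  bits := b
  blocks := r / (Q * h) + 1
  block := Q * h
  next := nextLevel Q h
  jump l := extendZero fun i => keyRank (levelKey Q h p (nextLevel Q h l)) (levelOrder Q h p l i)
  col := extendZero fun i => revCol Q h p (levelOrder Q h p h i)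
  row := extendZero fun i => rowKey p (levelOrder Q h p h i)
  val := extendZero fun i => v (levelOrder Q h p h i)
  rev := digitRev Q h
  sample _ _ _ := 0
  last l := extendZero fun i => keyRank (levelKey Q h p h) (levelOrder Q h p l i)
  depth := levelDepth Q h

/-- The index of a set of points. -/
noncomputable def pointIndex (Q h b : ℕ) (p : Fin r → Fin r × Fin r) (v : Fin r → G) :
    WordRAM.Index G :=
  { preIndex Q h b p v with
    sample := fun l k c => (preIndex Q h b p v).psum l c (k * (Q * h)) }

variable {Q h b : ℕ} {p : Fin r → Fin r × Fin r} {v : Fin r → G}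

theorem levelOrder_keyRank (l : ℕ) (q : Fin r) :
    levelOrder Q h p l ⟨keyRank (levelKey Q h p l) q, keyRank_lt _ _⟩ = q :=
  ranked_eq _ _

theorem keyRank_levelOrder (l : ℕ) (i : Fin r) :
    keyRank (levelKey Q h p l) (levelOrder Q h p l i) = i :=
  keyRank_ranked _ _

theorem pointIndex_col : (pointIndex Q h b p v).col =
    extendZero fun i => revCol Q h p (levelOrder Q h p h i) := rfl

theorem pointIndex_row : (pointIndex Q h b p v).row =
    extendZero fun i => rowKey p (levelOrder Q h p h i) := rfl

theorem pointIndex_val : (pointIndex Q h b p v).val =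
    extendZero fun i => v (levelOrder Q h p h i) := rfl

theorem pointIndex_last (l : ℕ) (i : Fin r) : (pointIndex Q h b p v).last l i =
    keyRank (levelKey Q h p h) (levelOrder Q h p l i) :=
  extendZero_fin (fun i => keyRank (levelKey Q h p h) (levelOrder Q h p l i)) i

theorem pointIndex_jump (l : ℕ) (i : Fin r) : (pointIndex Q h b p v).jump l i =
    keyRank (levelKey Q h p (nextLevel Q h l)) (levelOrder Q h p l i) :=
  extendZero_fin (fun i => keyRank (levelKey Q h p (nextLevel Q h l)) (levelOrder Q h p l i)) i

theorem pointIndex_col_last (l : ℕ) (i : Fin r) :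
    (pointIndex Q h b p v).col ((pointIndex Q h b p v).last l i) =
      revCol Q h p (levelOrder Q h p l i) := by
  rw [pointIndex_last, pointIndex_col, extendZero_of_lt _ (keyRank_lt _ _), levelOrder_keyRank]

theorem pointIndex_row_last (l : ℕ) (i : Fin r) :
    (pointIndex Q h b p v).row ((pointIndex Q h b p v).last l i) =
      rowKey p (levelOrder Q h p l i) := by
  rw [pointIndex_last, pointIndex_row, extendZero_of_lt _ (keyRank_lt _ _), levelOrder_keyRank]

theorem pointIndex_val_last (l : ℕ) (i : Fin r) :
    (pointIndex Q h b p v).val ((pointIndex Q h b p v).last l i) = v (levelOrder Q h p l i) := by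
  rw [pointIndex_last, pointIndex_val, extendZero_of_lt _ (keyRank_lt _ _), levelOrder_keyRank]

theorem pointIndex_key_last (l : ℕ) (i : Fin r) :
    (pointIndex Q h b p v).key l ((pointIndex Q h b p v).last l i) =
      levelKey Q h p l (levelOrder Q h p l i) := by
  unfold WordRAM.Index.key
  rw [pointIndex_col_last, pointIndex_row_last]
  rfl

theorem revCol_lt (hQ : 0 < Q) (hr : r < Q ^ h) (q : Fin r) : revCol Q h p q < Q ^ h :=
  digitRev_lt hQ _ _ ((p q).1.2.trans hr)

theorem pointIndex_valid (hQ : 2 ≤ Q) (hh : 0 < h) (hr : r < Q ^ h) (hb : r < 2 ^ (b + 1)) :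
    (pointIndex Q h b p v).Valid where
  base_pos := by show 0 < Q; omega
  block_pos := by show 0 < Q * h; positivity
  half_eq := rfl
  size_lt := hb
  next_le _ _ := min_le_left _ _
  jump_lt l _ i hi := by
    rw [show i = (⟨i, hi⟩ : Fin r) from rfl, pointIndex_jump]
    exact keyRank_lt _ _
  depth_lt l hl := levelDepth_nextLevel_lt hQ hl
  last_level i hi := by
    rw [show i = (⟨i, hi⟩ : Fin r) from rfl, pointIndex_last]
    exact keyRank_levelOrder h ⟨i, hi⟩
  last_jump l _ i hi := by
    rw [show i = (⟨i, hi⟩ : Fin r) from rfl, pointIndex_jump, pointIndex_last]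
    -- The jump leads to the position of the same point on the target level.
    refine (pointIndex_last (nextLevel Q h l) ⟨_, keyRank_lt _ _⟩).trans ?_
    rw [levelOrder_keyRank]
  last_lt l _ i hi := by
    rw [show i = (⟨i, hi⟩ : Fin r) from rfl, pointIndex_last]
    exact keyRank_lt _ _
  sorted l _ i j hij hj := by
    have hi : i < r := hij.trans_lt hj
    have h1 := pointIndex_key_last (Q := Q) (h := h) (b := b) (p := p) (v := v) l ⟨i, hi⟩
    have h2 := pointIndex_key_last (Q := Q) (h := h) (b := b) (p := p) (v := v) l ⟨j, hj⟩
    refine (h1.trans_le (le_of_not_gt fun h' => ?_)).trans_eq h2.symm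
    have := Fin.lt_def.1 ((key_ranked_lt _).1 h')
    exact hij.not_gt this
  col_lt i hi := by
    have hi : i < r := hi
    rw [pointIndex_col, extendZero_of_lt _ hi]
    exact revCol_lt (by omega) hr _
  row_lt i hi := by
    have hi : i < r := hi
    rw [pointIndex_row, extendZero_of_lt _ hi]
    exact rowKey_lt _ _
  rev_lt x hx := digitRev_lt (by omega) _ _ (hx.trans_lt hr)
  sample_eq _ _ _ _ _ _ := rfl

theorem pointIndex_levelSum (x y l : ℕ) : (pointIndex Q h b p v).levelSum x y l =
    ∑ q, if levelKey Q h p l q < x % Q ^ l * (r * r) + y ∧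
      revCol Q h p q / Q ^ l % Q < x / Q ^ l % Q then v q else 0 := by
  unfold WordRAM.Index.levelSum
  show ∑ j ∈ range r, _ = _
  rw [sum_range]
  refine Eq.trans ?_ (Equiv.sum_comp (levelOrder Q h p l) _)
  refine sum_congr rfl fun i _ => ?_
  rw [pointIndex_key_last, pointIndex_col_last, pointIndex_val_last]
  rfl

/-- The difference of two corner sums counts exactly the points in a half-strip. -/
theorem pointIndex_cornerSum_sub (hQ : 0 < Q) (hr : r < Q ^ h) {X Y Y' : ℕ} (hX : X ≤ r)
    (hY : Y ≤ r) (hYY : Y' ≤ Y) :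
    (pointIndex Q h b p v).cornerSum (digitRev Q h X) (Y * r) -
      (pointIndex Q h b p v).cornerSum (digitRev Q h X) (Y' * r) =
    ∑ q, if ((p q).1 : ℕ) < X ∧ Y' ≤ (p q).2 ∧ ((p q).2 : ℕ) < Y then v q else 0 := by
  unfold WordRAM.Index.cornerSum
  show ∑ l ∈ range h, _ - ∑ l ∈ range h, _ = _
  rw [← sum_sub_distrib]
  simp only [pointIndex_levelSum]
  simp only [← sum_sub_distrib]
  rw [sum_comm]
  refine sum_congr rfl fun q _ => ?_
  -- The weight is the value of the point, set to zero outside the rows in question.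
  have key := sum_digitRev hQ h (p q).1 X ((p q).1.2.trans hr) (hX.trans_lt hr)
    (if Y' ≤ (p q).2 ∧ ((p q).2 : ℕ) < Y then v q else 0)
  have hlt : ∀ l Z, Z ≤ r → (levelKey Q h p l q < digitRev Q h X % Q ^ l * (r * r) + Z * r ↔
      revCol Q h p q % Q ^ l < digitRev Q h X % Q ^ l ∨
      revCol Q h p q % Q ^ l = digitRev Q h X % Q ^ l ∧ ((p q).2 : ℕ) < Z) := by
    intro l Z hZ
    have h1 := rowKey_lt p q
    have h3 := rowKey_lt_iff p q Z
    unfold levelKey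
    rcases Nat.lt_or_ge Z r with hZr | hZr
    · rw [mul_add_lt_mul_add_iff h1, h3]
      exact Nat.mul_lt_mul_of_pos_right hZr (by omega)
    -- Here the row part `r * r` carries into the residue, so the comparison is made with the next
    -- residue and row part 0.
    · obtain rfl : Z = r := by omega
      have h4 := (p q).2.2
      have : digitRev Q h X % Q ^ l * (Z * Z) + Z * Z = (digitRev Q h X % Q ^ l + 1) * (Z * Z) + 0 := by
        ring
      rw [this, mul_add_lt_mul_add_iff h1 (by omega)]
      omega
  rw [ite_and, ← key]
  refine sum_congr rfl fun l _ => ?_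
  rw [show digitRev Q h (p q).1 = revCol Q h p q from rfl]
  simp only [hlt l Y hY, hlt l Y' (hYY.trans hY)]
  -- A group in front of that of `X` is counted by both corners and cancels, a group behind it by
  -- neither; only the group of `X` feels the row bounds.
  rcases lt_trichotomy (revCol Q h p q % Q ^ l) (digitRev Q h X % Q ^ l) with h1 | h1 | h1
  · simp [h1, h1.ne]
  · simp only [h1, lt_irrefl, false_or, true_and]
    by_cases h2 : revCol Q h p q / Q ^ l % Q < digitRev Q h X / Q ^ l % Q
    · simp only [h2, and_true, if_true]
      by_cases h3 : ((p q).2 : ℕ) < Y'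
      · simp [h3, h3.trans_le hYY, h3.not_ge]
      · simp [h3, not_lt.1 h3]
    · simp [h2]
  · simp [h1.not_gt, h1.ne']

theorem pointIndex_rectSum (hQ : 0 < Q) (hr : r < Q ^ h) (x₁ x₂ y₁ y₂ : Fin r) :
    let S := fun X Y => (pointIndex Q h b p v).cornerSum (digitRev Q h X) (Y * r)
    y₁ ≤ y₂ → x₁ ≤ x₂ →
    S (x₂ + 1) (y₂ + 1) - S (x₂ + 1) y₁ - S x₁ (y₂ + 1) + S x₁ y₁ = rectSum p v x₁ x₂ y₁ y₂ := by
  intro S hy hx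
  have hx' : (x₁ : ℕ) ≤ x₂ := hx
  have hy' : (y₁ : ℕ) ≤ y₂ := hy
  have h1 := pointIndex_cornerSum_sub (b := b) (p := p) (v := v) hQ hr (X := x₂ + 1) (Y := y₂ + 1)
    (Y' := y₁) x₂.2 y₂.2 (by omega)
  have h2 := pointIndex_cornerSum_sub (b := b) (p := p) (v := v) hQ hr (X := x₁) (Y := y₂ + 1)
    (Y' := y₁) x₁.2.le y₂.2 (by omega)
  -- A single corner sum also counts foreign groups, so the corners are paired by equal `X`.
  calc _ = (S (x₂ + 1) (y₂ + 1) - S (x₂ + 1) y₁) - (S x₁ (y₂ + 1) - S x₁ y₁) := by abel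
    _ = _ := by
      rw [h1, h2, ← sum_sub_distrib, rectSum, sum_filter]
      refine sum_congr rfl fun q _ => ?_
      simp only [Fin.le_def]
      by_cases hy1 : (y₁ : ℕ) ≤ (p q).2 ∧ ((p q).2 : ℕ) ≤ y₂
      · have hy2 : ((p q).2 : ℕ) < y₂ + 1 := by omega
        by_cases hx1 : ((p q).1 : ℕ) < x₁
        · simp [hy1, hy2, hx1, hx1.not_ge, show ((p q).1 : ℕ) < x₂ + 1 by omega]
        · simp [hy1, hy2, hx1, not_lt.1 hx1]
      · rw [if_neg (by omega), if_neg (by omega), if_neg (by omega), sub_zero]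

end PointIndex

/-! ### Memory layout -/

section Layout

open Finset WordRAM

variable {r N : ℕ} {G : Type*} [AddCommGroup G] (code : G ≃ Fin N) (D : Index G)
  (J : ℕ → JumpTable)

/-- The parts of the memory after the header. -/
def memPart : ℕ → List ℕ
  | 0 => tabulate D.size D.col
  | 1 => tabulate D.size D.row
  | 2 => tabulate D.size fun i => code (D.val i)
  | 3 => tabulate (D.size + 1) D.rev
  | 4 => tabulate (D.level * D.blocks * D.base) fun t =>
      code (D.sample (t / D.base / D.blocks) (t / D.base % D.blocks) (t % D.base))
  | l + 5 => (J l).items ++ (J l).bases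

/-- Address of a part. -/
def partAddr (j : ℕ) : ℕ := 16 + 8 * D.level + (concat (memPart code D J) j).length

/-- Description of a level. -/
def descriptor (l : ℕ) : ℕ → ℕ
  | 0 => D.next l
  | 1 => partAddr code D J (l + 5)
  | 2 => (J l).perWord
  | 3 => (J l).width
  | 4 => 2 ^ (J l).width
  | 5 => (J l).block
  | 6 => (J l).symbols
  | _ => partAddr code D J (l + 5) + (J l).items.length

/-- Contents of the header. -/
def headerCell : ℕ → ℕ
  | 0 => D.level
  | 1 => D.base
  | 2 => D.size
  | 3 => D.half
  | 4 => partAddr code D J 0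
  | 5 => partAddr code D J 1
  | 6 => partAddr code D J 2
  | 7 => partAddr code D J 3
  | 8 => partAddr code D J 4
  | 9 => D.blocks
  | 10 => D.block
  | t => descriptor code D J ((t - 16) / 8) ((t - 16) % 8)

/-- The whole memory. -/
def layout : List ℕ :=
  tabulate (16 + 8 * D.level) (headerCell code D J) ++ concat (memPart code D J) (D.level + 5)

variable {code D J}

omit [AddCommGroup G] in
theorem layout_length : (layout code D J).length = partAddr code D J (D.level + 5) := by
  simp [layout, partAddr]

omit [AddCommGroup G] in
theorem layout_header {t : ℕ} (ht : t < 16 + 8 * D.level) :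
    cell (layout code D J) t = headerCell code D J t := by
  rw [cell, layout, List.getD_append _ _ _ _ (by simpa using ht), tabulate_getD ht]

omit [AddCommGroup G] in
theorem layout_part {j t : ℕ} (hj : j < D.level + 5) (ht : t < (memPart code D J j).length) :
    partAddr code D J j + t < (layout code D J).length ∧
    cell (layout code D J) (partAddr code D J j + t) = (memPart code D J j).getD t 0 := by
  obtain ⟨h1, h2⟩ := concat_getD (memPart code D J) hj ht
  constructor
  · rw [layout_length, partAddr, partAddr]
    omega
  · rw [cell, layout, partAddr, List.getD_append_right _ _ _ _ (by simp; omega), ← h2]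
    congr 1
    simp
    omega

omit [AddCommGroup G] in
theorem layout_descriptor {l k : ℕ} (hl : l < D.level) (hk : k < 8) :
    cell (layout code D J) (16 + 8 * l + k) = descriptor code D J l k := by
  rw [layout_header (by omega)]
  have : headerCell code D J (16 + 8 * l + k) =
      descriptor code D J ((16 + 8 * l + k - 16) / 8) ((16 + 8 * l + k - 16) % 8) := by
    rw [show 16 + 8 * l + k = (5 + 8 * l + k) + 11 by omega]
    rfl
  rw [this]
  congr 1 <;> omega

/-- Apart from group codes and addresses, which are bounded separately, the numbers that occur fit
into `4 * (b + 1)` bits, the largest being the key bound `Q ^ h * r ^ 2`. -/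
theorem pointIndex_stored {Q h b : ℕ} {p : Fin r → Fin r × Fin r} {v : Fin r → G}
    (hr : 2 ≤ r) (hQ : 2 ≤ Q) (hh : 0 < h) (hrQ : r < Q ^ h) (hQh : Q ^ h ≤ 2 ^ (2 * (b + 1)))
    (hrb : r < 2 ^ (b + 1))
    (hJ : ∀ l < h, (J l).Valid (b + 1) (keyRank (levelKey Q h p l))
      (keyRank (levelKey Q h p (nextLevel Q h l))))
    {W : ℕ} (hD : D = pointIndex Q h b p v)
    (hW : 2 ^ (16 * (b + 1)) ≤ W) (hN : N ≤ W) (hlen : (layout code D J).length < W) :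
    D.Stored code W (cell (layout code D J)) := by
  have hV : D.Valid := hD ▸ pointIndex_valid hQ hh hrQ hrb
  have eQ : D.base = Q := by rw [hD]; rfl
  have eh : D.level = h := by rw [hD]; rfl
  have er : D.size = r := by rw [hD]; rfl
  have eb : D.bits = b := by rw [hD]; rfl
  have ebl : D.block = Q * h := by rw [hD]; rfl
  have ebs : D.blocks = r / (Q * h) + 1 := by rw [hD]; rfl
  have eha : D.half = 2 ^ b := by rw [hD]; rfl
  have ej : ∀ l i, D.jump l (i : Fin r) =
      keyRank (levelKey Q h p (nextLevel Q h l)) (levelOrder Q h p l i) := by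
    rw [hD]; exact pointIndex_jump
  clear hD
  have hpow : ∀ n ≤ 16, 2 ^ (n * (b + 1)) ≤ W := fun n hn =>
    (Nat.pow_le_pow_right (by norm_num) (Nat.mul_le_mul_right _ hn)).trans hW
  have hhlen : 16 + 8 * h < W := by
    refine lt_of_le_of_lt ?_ hlen
    rw [layout_length, partAddr, eh]
    omega
  have hb2 : 2 ≤ 2 ^ (b + 1) := by rw [pow_succ]; have := Nat.one_le_two_pow (n := b); omega
  have h100 : 100 < W := by
    have : 2 ^ 16 ≤ 2 ^ (16 * (b + 1)) := Nat.pow_le_pow_right (by norm_num) (by omega)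
    norm_num at this
    omega
  have hhQ : h < Q ^ h := Nat.lt_pow_self hQ
  have hQQ : Q ≤ Q ^ h := Nat.le_self_pow hh.ne' Q
  have hQW : Q ^ h < W := by
    refine hQh.trans_lt (lt_of_lt_of_le ?_ hW)
    exact Nat.pow_lt_pow_right (by norm_num) (by omega)
  have hblock : Q * h < W := by
    calc Q * h < Q ^ h * Q ^ h := by nlinarith
      _ ≤ 2 ^ (2 * (b + 1)) * 2 ^ (2 * (b + 1)) := Nat.mul_le_mul hQh hQh
      _ = 2 ^ (4 * (b + 1)) := by rw [← pow_add]; congr 1; omega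
      _ ≤ W := hpow 4 (by norm_num)
  have hrr : r * r < 2 ^ (2 * (b + 1)) := by
    rw [mul_comm 2, pow_mul, sq]
    nlinarith
  have hrrW : r * r ≤ W := hrr.le.trans (hpow 2 (by norm_num))
  have hrW : r + 2 * 2 ^ b < W := by
    rw [mul_comm 2, ← pow_succ]
    calc r + 2 ^ (b + 1) < 2 ^ (b + 1) + 2 ^ (b + 1) := by omega
      _ ≤ 2 ^ (b + 1) * 2 ^ (b + 1) := by nlinarith
      _ = 2 ^ (2 * (b + 1)) := by rw [← pow_add]; congr 1; omega
      _ ≤ W := hpow 2 (by norm_num)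
  have hcode : ∀ g : G, (code g : ℕ) < W := fun g => (code g).2.trans_le hN
  have hlam : 4 * (b + 1) < W :=
    Nat.lt_two_pow_self.trans_le (hpow 4 (by norm_num))
  -- The end `t = length` is included because the address of a possibly empty list of bases may be
  -- the end of its part.
  have hadd : ∀ j < h + 5, ∀ t ≤ (memPart code D J j).length, partAddr code D J j + t < W := by
    intro j hj t ht
    refine lt_of_le_of_lt ?_ hlen
    rw [layout_length]
    have : partAddr code D J (j + 1) = partAddr code D J j + (memPart code D J j).length := by
      rw [partAddr, concat, List.length_append, partAddr]
      omega
    have h2 : partAddr code D J (j + 1) ≤ partAddr code D J (D.level + 5) := by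
      rw [partAddr, partAddr, concat_length, concat_length]
      exact Nat.add_le_add_left
        (sum_le_sum_of_subset (Finset.range_subset_range.2 (by omega))) _
    linarith
  have hdesc : ∀ l < h, ∀ k, descriptor code D J l k < W := by
    intro l hl k
    have hJl := hJ l hl
    have hb' : 2 ^ (b + 1) ≤ W := by simpa using hpow 1 (by norm_num)
    unfold descriptor
    split
    · have := hV.next_le l (by omega)
      omega
    · exact hadd _ (by omega) 0 (Nat.zero_le _)
    · exact hJl.perWord_le.trans_lt hlam
    · have := hJl.width_le
      omega
    · exact ((Nat.pow_le_pow_right (by norm_num) hJl.width_le).trans_lt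
        (Nat.pow_lt_pow_right (by norm_num) (by omega))).trans_le (hpow 3 (by norm_num))
    · exact hJl.block_lt.trans_le hb'
    · exact hJl.symbols_lt.trans_le hb'
    · exact hadd _ (by omega) _ (by simp [memPart])
  have hblocks : D.blocks < W := by
    have := Nat.div_le_self r (Q * h)
    have := Nat.one_le_two_pow (n := b)
    omega
  have hmem : ∀ x ∈ layout code D J, x < W := by
    intro x hx
    rcases List.mem_append.1 hx with hx | hx
    · refine forall_mem_tabulate (P := (· < W)).2 (fun t ht => ?_) x hx
      unfold headerCell
      split
      · omega
      · omega
      · omega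
      · omega
      iterate 5 exact hadd _ (by omega) 0 (Nat.zero_le _)
      · exact hblocks
      · omega
      · exact hdesc _ (by omega) _
    · refine forall_mem_concat (P := (· < W)) (fun j hj => ?_) x hx
      unfold memPart
      split
      · rw [forall_mem_tabulate]
        intro i hi
        refine (hV.col_lt i hi).trans ?_
        rwa [eQ, eh]
      · rw [forall_mem_tabulate]
        intro i hi
        refine (hV.row_lt i hi).trans_le ?_
        rwa [er]
      · rw [forall_mem_tabulate]
        exact fun i _ => hcode _
      · rw [forall_mem_tabulate]
        intro i hi
        refine (hV.rev_lt i (by omega)).trans ?_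
        rwa [eQ, eh]
      · rw [forall_mem_tabulate]
        exact fun i _ => hcode _
      · rename_i l
        intro y hy
        have hJl := hJ l (by omega)
        rcases List.mem_append.1 hy with hy | hy
        · exact (hJl.items_lt y hy).trans_le (hpow 4 (by norm_num))
        · exact (hJl.bases_lt y hy).trans_le (hpow 4 (by norm_num))
  have hcell : ∀ i, cell (layout code D J) i < W := by
    intro i
    rw [cell, List.getD_eq_getElem?_getD]
    rcases e : (layout code D J)[i]? with _ | x
    · simp; omega
    · simpa using hmem x (List.mem_of_getElem? e)
  have hseg : ∀ {j t : ℕ}, j < h + 5 → t < (memPart code D J j).length →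
      partAddr code D J j + t < W ∧
      cell (layout code D J) (partAddr code D J j + t) = (memPart code D J j).getD t 0 :=
    fun hj ht => ⟨(layout_part (by omega) ht).1.trans hlen,
      (layout_part (by omega) ht).2⟩
  have hhead : ∀ t < 16, cell (layout code D J) t = headerCell code D J t :=
    fun t ht => layout_header (by omega)
  have hde : ∀ l < D.level, ∀ k < 8,
      cell (layout code D J) (16 + 8 * l + k) = descriptor code D J l k :=
    fun l hl k hk => layout_descriptor hl hk
  refine
    { lt := hcell
      card_le := hN
      const_lt := h100
      key_lt := ?_
      level_lt := by omega
      base_lt := by omega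
      block_lt := by omega
      pow_lt := by rw [eQ, eh]; exact hQW
      half_lt := by rw [er, eha]; exact hrW
      level_eq := hhead 0 (by norm_num)
      base_eq := hhead 1 (by norm_num)
      size_eq := hhead 2 (by norm_num)
      half_eq := hhead 3 (by norm_num)
      blocks_eq := hhead 9 (by norm_num)
      block_eq := hhead 10 (by norm_num)
      col := ?_
      row := ?_
      val := ?_
      rev := ?_
      sample := ?_
      descr_lt := fun l hl => by omega
      next := fun l hl => hde l hl 0 (by norm_num)
      entry_lt := ?_
      jump := ?_ }
  · rw [eQ, eh, er]
    calc Q ^ h * (r * r) < 2 ^ (2 * (b + 1)) * 2 ^ (2 * (b + 1)) :=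
          Nat.mul_lt_mul_of_le_of_lt hQh hrr (by positivity)
      _ = 2 ^ (4 * (b + 1)) := by rw [← pow_add]; congr 1; omega
      _ ≤ W := hpow 4 (by norm_num)
  · intro i hi
    rw [hhead 4 (by norm_num)]
    obtain ⟨h1, h2⟩ := hseg (j := 0) (t := i) (by omega) (by simpa [memPart] using hi)
    exact ⟨h1, h2.trans (tabulate_getD hi _)⟩
  · intro i hi
    rw [hhead 5 (by norm_num)]
    obtain ⟨h1, h2⟩ := hseg (j := 1) (t := i) (by omega) (by simpa [memPart] using hi)
    exact ⟨h1, h2.trans (tabulate_getD hi _)⟩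
  · intro i hi
    rw [hhead 6 (by norm_num)]
    obtain ⟨h1, h2⟩ := hseg (j := 2) (t := i) (by omega) (by simpa [memPart] using hi)
    exact ⟨h1, h2.trans (tabulate_getD hi _)⟩
  · intro i hi
    rw [hhead 7 (by norm_num)]
    obtain ⟨h1, h2⟩ := hseg (j := 3) (t := i) (by omega)
      (by simpa [memPart] using Nat.lt_succ_of_le hi)
    exact ⟨h1, h2.trans (tabulate_getD (Nat.lt_succ_of_le hi) _)⟩
  · intro l hl k hk c hc
    rw [hhead 8 (by norm_num)]
    -- The `+ 1` in `blocks` provides the sample at the last, possibly incomplete, block.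
    have hk' : k < D.blocks := by
      rw [ebs]
      refine Nat.lt_succ_of_le ((Nat.le_div_iff_mul_le (by positivity)).2 ?_)
      rwa [← ebl, ← er]
    have e1 : ((l * D.blocks + k) * D.base + c) / D.base = l * D.blocks + k := by
      rw [mul_comm, Nat.mul_add_div (by omega), Nat.div_eq_of_lt hc, add_zero]
    have e2 : ((l * D.blocks + k) * D.base + c) % D.base = c := by
      rw [mul_comm, Nat.mul_add_mod, Nat.mod_eq_of_lt hc]
    have e3 : (l * D.blocks + k) / D.blocks = l := by
      rw [mul_comm, Nat.mul_add_div (by omega), Nat.div_eq_of_lt hk', add_zero]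
    have e4 : (l * D.blocks + k) % D.blocks = k := by
      rw [mul_comm, Nat.mul_add_mod, Nat.mod_eq_of_lt hk']
    have hlt : (l * D.blocks + k) * D.base + c < D.level * D.blocks * D.base := by
      have h1 : (l + 1) * D.blocks ≤ D.level * D.blocks := Nat.mul_le_mul_right _ hl
      have h2 : (l * D.blocks + k + 1) * D.base ≤ D.level * D.blocks * D.base := by
        refine Nat.mul_le_mul_right _ ?_
        rw [add_mul] at h1
        omega
      rw [add_mul (_ + _)] at h2
      omega
    obtain ⟨h1, h2⟩ := hseg (j := 4) (t := (l * D.blocks + k) * D.base + c) (by omega)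
      (by simpa [memPart] using hlt)
    rw [add_assoc]
    refine ⟨h1, h2.trans ((tabulate_getD hlt _).trans ?_)⟩
    rw [e1, e2, e3, e4]
  · intro l hl i hi
    have hJl := hJ l (by omega)
    have hq := keyRank_levelOrder (Q := Q) (h := h) (p := p) l ⟨i, by omega⟩
    have h1 := hJl.index_lt (levelOrder Q h p l ⟨i, by omega⟩)
    have h2 := hJl.shift_le (levelOrder Q h p l ⟨i, by omega⟩)
    rw [hq] at h1 h2
    rw [hde l hl 1 (by norm_num), hde l hl 2 (by norm_num), hde l hl 3 (by norm_num)]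
    refine ⟨hadd _ (by omega) _ ?_, h2.trans_lt hlam⟩
    simp only [memPart, List.length_append]
    simp only at h1
    show i / (J l).perWord ≤ _
    omega
  · intro l hl i hi e he
    have hJl := hJ l (by omega)
    have hq := keyRank_levelOrder (Q := Q) (h := h) (p := p) l ⟨i, by omega⟩
    have h1 := hJl.index_lt (levelOrder Q h p l ⟨i, by omega⟩)
    have h2 := hJl.base_lt (levelOrder Q h p l ⟨i, by omega⟩)
    have h3 := hJl.rank_eq (levelOrder Q h p l ⟨i, by omega⟩)
    rw [hq] at h1 h2 h3
    simp only at h1 h2 h3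
    rw [hde l hl 1 (by norm_num), hde l hl 2 (by norm_num), hde l hl 3 (by norm_num),
      hde l hl 4 (by norm_num)] at he
    rw [hde l hl 5 (by norm_num), hde l hl 6 (by norm_num), hde l hl 7 (by norm_num)]
    simp only [descriptor] at he ⊢
    have hitem := (hseg (j := l + 5) (t := i / (J l).perWord) (by omega)
      (by simp only [memPart, List.length_append]; omega)).2
    simp only [memPart] at hitem
    rw [hitem, List.getD_append _ _ _ _ h1] at he
    -- The word arithmetic of the program is the decoding `JumpTable.entry`.
    change e = (J l).entry i at he
    rw [← he] at h2 h3
    obtain ⟨h4, h5⟩ := hseg (j := l + 5)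
      (t := (J l).items.length + (i / (J l).block * (J l).symbols + e / (J l).block)) (by omega)
      (by simp only [memPart, List.length_append]; omega)
    simp only [memPart] at h5
    rw [List.getD_append_right _ _ _ _ (Nat.le_add_right _ _), Nat.add_sub_cancel_left] at h5
    rw [add_assoc (_ + _), add_assoc (partAddr code D J (l + 5))]
    refine ⟨h4, ?_⟩
    rw [h5, h3]
    exact (ej l ⟨i, by omega⟩).symm

end Layout

/-! ### Space and time bounds -/

section Core

open Finset WordRAM

variable {r N : ℕ} {G : Type*} [AddCommGroup G]

/-- Needed to absorb the `O(lam ^ 2)` surplus samples of incomplete blocks into `O(r)`. -/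
theorem sq_le_two_mul_two_pow (n : ℕ) : n ^ 2 ≤ 2 * 2 ^ n := by
  rcases Nat.lt_or_ge n 4 with h | h
  · interval_cases n <;> norm_num
  · induction n, h using Nat.le_induction with
    | base => norm_num
    | succ n hn ih =>
      rw [pow_succ 2]
      nlinarith

omit [AddCommGroup G] in
theorem layout_length_eq {code : G ≃ Fin N} {D : Index G} {J : ℕ → JumpTable} :
    (layout code D J).length = 16 + 8 * D.level + (4 * D.size + 1 +
      D.level * D.blocks * D.base) + ((∑ l ∈ range D.level, (J l).items.length) +
      ∑ l ∈ range D.level, (J l).bases.length) := by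
  have h5 : ∀ l, (memPart code D J (5 + l)).length = (J l).items.length + (J l).bases.length :=
    fun l => by rw [add_comm, memPart, List.length_append]
  rw [layout_length, partAddr, concat_length, add_comm D.level 5, sum_range_add, ← sum_add_distrib]
  simp only [h5]
  simp only [sum_range_succ, range_zero, sum_empty, memPart, tabulate_length]
  ring

/-- In bits, the symbols cost `2 * a` times the total jump length, at most `8 * K * lam` per point,
and the block surplus `h * η` at most `2 * K * lam`; both use `a * h ≤ 2 * lam`. Division by `lam`
gives words. -/
theorem sum_items_le {lam a h K η : ℕ} (items : ℕ → ℕ) (hlam : 0 < lam) (hK : 0 < K) (hh : 0 < h)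
    (ha : 0 < a) (hah : a * h ≤ 2 * lam) (hhK : h ≤ (2 ^ a) ^ K) (hη : η ≤ a * K)
    (hitems : ∀ l < h, lam * items l ≤
      r * (2 * (a * (nextLevel (2 ^ a) h l - l)) + η) + lam) :
    ∑ l ∈ range h, items l ≤ 10 * K * r + h := by
  have h1 : ∑ l ∈ range h, (nextLevel (2 ^ a) h l - l) ≤ K * h + 1 := by
    refine (sum_le_sum fun l _ => ?_).trans
      (sum_jumpLength_le (Nat.le_self_pow ha.ne' 2) hhK)
    unfold nextLevel
    omega
  refine Nat.le_of_mul_le_mul_left ?_ hlam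
  rw [mul_sum]
  refine (sum_le_sum fun l hl => hitems l (mem_range.1 hl)).trans ?_
  rw [sum_add_distrib, ← mul_sum, sum_add_distrib, ← mul_sum, ← mul_sum, sum_const, sum_const,
    card_range, smul_eq_mul, smul_eq_mul]
  have h2 : a * (K * h + 1) ≤ 4 * K * lam := by
    calc a * (K * h + 1) ≤ a * (K * h + K * h) := by
          gcongr; exact Nat.mul_pos hK hh
      _ = 2 * K * (a * h) := by ring
      _ ≤ 2 * K * (2 * lam) := by gcongr
      _ = _ := by ring
  have h3 : h * η ≤ 2 * K * lam := by
    calc h * η ≤ h * (a * K) := by gcongr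
      _ = K * (a * h) := by ring
      _ ≤ K * (2 * lam) := by gcongr
      _ = _ := by ring
  calc _ ≤ r * (2 * (a * (K * h + 1)) + h * η) + h * lam := by gcongr
    _ ≤ r * (2 * (4 * K * lam) + 2 * K * lam) + h * lam := by gcongr
    _ = _ := by ring

/-- The surplus `η` is there for this: with `2 ^ η ≥ h`, each level needs about `2 * r / h` base
values. -/
theorem sum_bases_le {h η : ℕ} (bases : ℕ → ℕ) (hη : h ≤ 2 ^ η)
    (hb : ∀ l < h, 2 ^ η * bases l ≤ 2 * r + 2 ^ η) :
    ∑ l ∈ range h, bases l ≤ 2 * r + h := by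
  have h1 : ∀ l ∈ range h, bases l ≤ 2 * r / 2 ^ η + 1 := by
    intro l hl
    rw [← Nat.add_div_right _ (by positivity), Nat.le_div_iff_mul_le (by positivity), mul_comm]
    exact hb l (mem_range.1 hl)
  refine (sum_le_sum h1).trans ?_
  rw [sum_const, card_range, smul_eq_mul, mul_add, mul_one]
  exact Nat.add_le_add_right ((Nat.mul_le_mul_right _ hη).trans (Nat.mul_div_le _ _)) _

theorem layout_length_le {code : G ≃ Fin N} {J : ℕ → JumpTable} {a b h K η : ℕ}
    {p : Fin r → Fin r × Fin r} {v : Fin r → G} (hK : 0 < K) (hh : 0 < h)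
    (ha : 0 < a) (haQ : 2 ^ a ≤ 2 * (b + 1)) (hah : a * h ≤ 2 * (b + 1)) (hb : 2 ^ (b + 1) ≤ 2 * r)
    (hhK : h ≤ (2 ^ a) ^ K) (hη : h ≤ 2 ^ η) (hηK : η ≤ a * K)
    (hitems : ∀ l < h, (b + 1) * (J l).items.length ≤
      r * (2 * (a * (nextLevel (2 ^ a) h l - l)) + η) + (b + 1))
    (hbases : ∀ l < h, 2 ^ η * (J l).bases.length ≤ 2 * r + 2 ^ η) :
    (layout code (pointIndex (2 ^ a) h b p v) J).length ≤ 100 * K * r := by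
  have h1 := sum_items_le _ (by omega) hK hh ha hah hhK hηK hitems
  have h2 := sum_bases_le _ hη hbases
  rw [layout_length_eq]
  show 16 + 8 * h + (4 * r + 1 + h * (r / (2 ^ a * h) + 1) * 2 ^ a) + (∑ l ∈ range h, _ +
    ∑ l ∈ range h, _) ≤ _
  have h3 : h ≤ 2 * (b + 1) := by nlinarith
  have h4 : h * (r / (2 ^ a * h) + 1) * 2 ^ a ≤ r + 16 * r := by
    calc h * (r / (2 ^ a * h) + 1) * 2 ^ a = (2 ^ a * h) * (r / (2 ^ a * h)) + h * 2 ^ a := by ring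
      _ ≤ r + 2 * (b + 1) * (2 * (b + 1)) :=
          Nat.add_le_add (Nat.mul_div_le _ _) (Nat.mul_le_mul h3 haQ)
      _ ≤ r + 16 * r := by
          have := sq_le_two_mul_two_pow (b + 1)
          nlinarith
  have h5 : b + 1 ≤ 2 * r := Nat.lt_two_pow_self.le.trans hb
  have h6 : 100 * r ≤ 100 * K * r := by nlinarith
  have h7 : 90 * r ≤ 90 * K * r := by nlinarith
  have h8 : 100 * K * r = 10 * K * r + 90 * K * r := by ring
  omega

omit [AddCommGroup G] in
-- There are `h` levels, each with at most `lam + Q * h` descents of `O(Q * K)` steps, where `h =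
-- O(lam)`.
theorem cornerTime_le {D : Index G} {Q h b K d : ℕ} (hD : D.level = h) (hb : D.bits = b)
    (hbl : D.block = Q * h) (hQ : 2 ≤ Q) (hK : 0 < K) (hh : h ≤ 2 * (b + 1)) (hd : d = Q * K + 1) :
    4 * D.cornerTime d + 300 ≤ 20000 * Q ^ 2 * K * (b + 1) ^ 2 := by
  unfold Index.cornerTime Index.levelTime
  rw [hD, hb, hbl, hd]
  have h0 : 2 ≤ Q * K := by nlinarith
  have h1 : (Q * K + 1) * 101 + 101 ≤ 202 * (Q * K) := by omega
  have h2 : Q * h ≤ 2 * Q * (b + 1) :=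
    (Nat.mul_le_mul_left Q hh).trans_eq (by ring)
  have h3 : b + 1 ≤ Q * (b + 1) := Nat.le_mul_of_pos_left _ (by omega)
  have hlam : 1 ≤ b + 1 := by omega
  clear hb
  generalize b + 1 = lam at *
  have h4 : 1 ≤ Q ^ 2 * K * lam := Nat.one_le_iff_ne_zero.2 (by positivity)
  have h5 : 1 ≤ Q ^ 2 * K * lam ^ 2 := Nat.one_le_iff_ne_zero.2 (by positivity)
  calc _ = 4 * (h * ((lam + Q * h) * ((Q * K + 1) * 101 + 101) + 201) + 100) + 300 := by ring
    _ ≤ 4 * (2 * lam * ((Q * lam + 2 * Q * lam) * (202 * (Q * K)) + 201) + 100) + 300 := by gcongr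
    _ = 4 * (2 * lam * (606 * (Q ^ 2 * K * lam) + 201 * 1)) + 700 * 1 := by ring
    _ ≤ 4 * (2 * lam * (606 * (Q ^ 2 * K * lam) + 201 * (Q ^ 2 * K * lam))) +
        700 * (Q ^ 2 * K * lam ^ 2) := by gcongr
    _ = 7156 * (Q ^ 2 * K * lam ^ 2) := by ring
    _ ≤ 20000 * (Q ^ 2 * K * lam ^ 2) := by gcongr; norm_num
    _ = _ := by ring

/-- The data structure for numbers of `b + 1` bits and branching `2 ^ a`. -/
theorem exists_memory {a b w : ℕ} (code : G ≃ Fin N) (p : Fin r → Fin r × Fin r) (v : Fin r → G)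
    (hr : 2 ≤ r) (ha : 0 < a) (hab : a ≤ b + 1) (haQ : 2 ^ a ≤ 2 * (b + 1)) (hrb : r < 2 ^ (b + 1))
    (hb : 2 ^ (b + 1) ≤ 2 * r) (hw : 16 * (b + 1) ≤ w) (hN : N ≤ 2 ^ w) :
    ∃ mem : List (BitVec w), ∀ K, 0 < K → b + 2 ≤ (2 ^ a) ^ K →
      mem.length ≤ 100 * K * r ∧
      ∀ x₁ x₂ y₁ y₂ : Fin r, ∃ (s : Regs w) (t : ℕ),
        Exec mem code queryProg (initRegs w x₁ x₂ y₁ y₂) s t ∧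
        (s 0).toNat = (code (rectSum p v x₁ x₂ y₁ y₂) : ℕ) ∧
        t ≤ 20000 * (2 ^ a) ^ 2 * K * (b + 1) ^ 2 := by
  -- Enough digits for all columns and the bound `r` itself, but still `a * h = O(lam)`.
  obtain ⟨h, hh⟩ : ∃ h, h = (b + 1) / a + 1 := ⟨_, rfl⟩
  have hh0 : 0 < h := hh ▸ Nat.succ_pos _
  have hah : a * h ≤ 2 * (b + 1) := by
    have := Nat.mul_div_le (b + 1) a
    rw [hh, mul_add]
    omega
  have hbh : b + 1 ≤ a * h := by
    rw [hh]
    exact (Nat.lt_mul_div_succ _ ha).le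
  have hhb : h ≤ b + 2 := by
    have := Nat.div_le_self (b + 1) a
    omega
  have hQ : 2 ≤ 2 ^ a := Nat.le_self_pow ha.ne' 2
  have hrQ : r < (2 ^ a) ^ h := by
    rw [← pow_mul]
    exact hrb.trans_le (Nat.pow_le_pow_right (by norm_num) hbh)
  have hQh : (2 ^ a) ^ h ≤ 2 ^ (2 * (b + 1)) := by
    rw [← pow_mul]
    exact Nat.pow_le_pow_right (by norm_num) hah
  -- `η = Nat.clog 2 h` is the least surplus with `2 ^ η ≥ h`.
  have hJ : ∀ l, ∃ J : JumpTable, l < h →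
      J.Valid (b + 1) (keyRank (levelKey (2 ^ a) h p l))
        (keyRank (levelKey (2 ^ a) h p (nextLevel (2 ^ a) h l))) ∧
      (b + 1) * J.items.length ≤
        r * (2 * (a * (nextLevel (2 ^ a) h l - l)) + Nat.clog 2 h) + (b + 1) ∧
      2 ^ Nat.clog 2 h * J.bases.length ≤ 2 * r + 2 ^ Nat.clog 2 h := by
    intro l
    by_cases hl : l < h
    · have hn : l < nextLevel (2 ^ a) h l := by
        have := jumpLength_pos (by omega : 0 < 2 ^ a) l
        unfold nextLevel
        omega
      obtain ⟨n, hn'⟩ := Nat.exists_eq_add_of_lt hn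
      have e : nextLevel (2 ^ a) h l = l + (nextLevel (2 ^ a) h l - l) := by omega
      obtain ⟨J, h1, h2⟩ := exists_jumpTable hr hrb hb (levelKey_injective (2 ^ a) h p l)
        (levelKey_lex (by omega) h p l (nextLevel (2 ^ a) h l - l))
        (s := a * (nextLevel (2 ^ a) h l - l)) (η := Nat.clog 2 h)
        (Nat.mul_pos ha (by omega)) (fun q => by
          rw [levelSymbol, pow_mul]
          exact Nat.mod_lt _ (by positivity))
      rw [← e] at h1
      exact ⟨J, fun _ => ⟨h1, h2⟩⟩
    · exact ⟨⟨0, 0, 0, 0, [], []⟩, fun h => absurd h hl⟩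
  choose J hJ using hJ
  have hη : h ≤ 2 ^ Nat.clog 2 h := Nat.le_pow_clog (by norm_num) h
  have hlength : ∀ K, 0 < K → h ≤ (2 ^ a) ^ K →
      (layout code (pointIndex (2 ^ a) h b p v) J).length ≤ 100 * K * r := fun K hK hhK =>
    layout_length_le hK hh0 ha haQ hah hb hhK hη
      (Nat.clog_le_of_le_pow (by rwa [← pow_mul] at hhK))
      (fun l hl => (hJ l hl).2.1) (fun l hl => (hJ l hl).2.2)
  have hW : 2 ^ (16 * (b + 1)) ≤ 2 ^ w := Nat.pow_le_pow_right (by norm_num) hw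
  have hlen : (layout code (pointIndex (2 ^ a) h b p v) J).length < 2 ^ w := by
    -- The memory does not depend on `K`, so the crude choice `K = h` suffices to see that addresses
    -- fit into a word.
    refine (hlength h hh0 (Nat.lt_pow_self hQ).le).trans_lt (lt_of_lt_of_le ?_ hW)
    have h1 : b + 1 < 2 ^ (b + 1) := Nat.lt_two_pow_self
    calc 100 * h * r ≤ 2 ^ 7 * (2 ^ (b + 1)) * 2 ^ (b + 1) := by
          gcongr
          · norm_num
          · omega
      _ = 2 ^ (7 + (b + 1) + (b + 1)) := by rw [← pow_add, ← pow_add]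
      _ < 2 ^ (16 * (b + 1)) := Nat.pow_lt_pow_right (by norm_num) (by omega)
  have hM := pointIndex_stored (code := code) (v := v) hr hQ hh0 hrQ hQh hrb
    (fun l hl => (hJ l hl).1) rfl hW hN hlen
  have hV : (pointIndex (2 ^ a) h b p v).Valid := pointIndex_valid hQ hh0 hrQ hrb
  refine ⟨words w (layout code (pointIndex (2 ^ a) h b p v) J), fun K hK hbK => ⟨?_, ?_⟩⟩
  · rw [words, List.length_map]
    exact hlength K hK (by omega)
  · intro x₁ x₂ y₁ y₂
    let σ : ℕ → ℕ := fun k => if k = 0 then x₁ else if k = 1 then x₂ else if k = 2 then y₁ else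
      if k = 3 then y₂ else 0
    have hσ : Holds w (initRegs w x₁ x₂ y₁ y₂) σ := by
      intro k _
      match k with
      | 0 | 1 | 2 | 3 => rfl
      | k + 4 => rfl
    obtain ⟨s, σ', t, e1, e2, e3, e4⟩ := run_queryProg (σ := σ) hV hM (d := 2 ^ a * K + 1)
      (fun l _ => levelDepth_le hQ (by omega) l) x₁.2 x₂.2 y₁.2 y₂.2 rfl rfl rfl rfl _ hσ
    refine ⟨s, t, e1, ?_, e3.trans (cornerTime_le rfl rfl rfl hQ hK (show h ≤ 2 * (b + 1) by omega) rfl)⟩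
    rw [e2 0 (by norm_num), e4, BitVec.toNat_ofNat,
      Nat.mod_eq_of_lt ((code _).2.trans_le hN)]
    congr 2
    split_ifs with hxy
    · refine (Finset.sum_eq_zero fun q hq => ?_).symm
      simp only [mem_filter, Fin.le_def] at hq
      omega
    · rw [not_or, not_lt, not_lt] at hxy
      exact pointIndex_rectSum (by omega) hrQ x₁ x₂ y₁ y₂ hxy.2 hxy.1

end Core

/-- The choice of the branching `2 ^ a` for a given exponent `ε`. -/
theorem exists_branching {L ε : ℝ} {b : ℕ} (hL : 1 ≤ L) (hε : 0 < ε) (hbL : (b : ℝ) ≤ L)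
    (hLb : L < b + 1) :
    ∃ a K : ℕ, 0 < a ∧ 0 < K ∧ a ≤ b + 1 ∧ 2 ^ a ≤ 2 * (b + 1) ∧ b + 2 ≤ (2 ^ a) ^ K ∧
      ((2 ^ a) ^ 2 : ℝ) ≤ 16 * L ^ ε ∧ (K : ℝ) ≤ 5 * max 1 (1 / ε) := by
  -- Capping the exponent keeps the base at `O(b)` for large `ε` and turns `1 / δ` into `max 1 (1 /
  -- ε)`.
  obtain ⟨δ, hδ⟩ : ∃ δ, δ = min ε 1 := ⟨_, rfl⟩
  have hδ0 : 0 < δ := hδ ▸ lt_min hε one_pos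
  have hδ1 : δ ≤ 1 := hδ ▸ min_le_right _ _
  have hδε : δ ≤ ε := hδ ▸ min_le_left _ _
  have hL0 : 0 < L := one_pos.trans_le hL
  have hx1 : 1 ≤ L ^ (δ / 2) := Real.one_le_rpow hL (by positivity)
  have hxL : L ^ (δ / 2) ≤ L := by
    simpa using Real.rpow_le_rpow_of_exponent_le hL (by linarith : δ / 2 ≤ 1)
  obtain ⟨q, hq⟩ : ∃ q, q = ⌊L ^ (δ / 2)⌋₊ + 1 := ⟨_, rfl⟩
  have hq2 : 2 ≤ q := by
    have : 1 ≤ ⌊L ^ (δ / 2)⌋₊ := Nat.le_floor (by simpa using hx1)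
    omega
  have hqb : q ≤ b + 1 := by
    rw [hq]
    exact (Nat.floor_lt (by positivity)).2 (by push_cast; linarith)
  have hxq : L ^ (δ / 2) ≤ q := by
    rw [hq, Nat.cast_add_one]
    exact (Nat.lt_floor_add_one _).le
  have hqx : (q : ℝ) ≤ 2 * L ^ (δ / 2) := by
    rw [hq, Nat.cast_add_one]
    have := Nat.floor_le (zero_le_one.trans hx1)
    linarith
  have ha : 0 < Nat.clog 2 q := Nat.clog_pos (by norm_num) hq2
  have hqa : q ≤ 2 ^ Nat.clog 2 q := Nat.le_pow_clog (by norm_num) q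
  have haq : 2 ^ Nat.clog 2 q ≤ 2 * q := by
    have h := Nat.pow_pred_clog_lt_self (b := 2) (by norm_num) hq2
    calc 2 ^ Nat.clog 2 q = 2 ^ ((Nat.clog 2 q).pred + 1) := by
          rw [← Nat.succ_eq_add_one, Nat.succ_pred ha.ne']
      _ = 2 * 2 ^ (Nat.clog 2 q).pred := pow_succ' _ _
      _ ≤ 2 * q := by omega
  have hxa : L ^ (δ / 2) ≤ 2 ^ Nat.clog 2 q := hxq.trans (by exact_mod_cast hqa)
  -- The power `2 / δ` of `L ^ (δ / 2)` is `L`; two further factors, each at least 2, cover `b + 2 ≤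
  -- 4 * L`.
  refine ⟨Nat.clog 2 q, ⌈2 / δ⌉₊ + 2, ha, by omega,
    Nat.clog_le_of_le_pow (hqb.trans Nat.lt_two_pow_self.le), by omega, ?_, ?_, ?_⟩
  · have h1 : L ≤ (2 ^ Nat.clog 2 q : ℝ) ^ ⌈2 / δ⌉₊ := by
      calc L = (L ^ (δ / 2)) ^ (2 / δ) := by
            rw [← Real.rpow_mul hL0.le, div_mul_div_cancel₀ (by norm_num), div_self hδ0.ne',
              Real.rpow_one]
        _ ≤ (L ^ (δ / 2)) ^ (⌈2 / δ⌉₊ : ℝ) := Real.rpow_le_rpow_of_exponent_le hx1 (Nat.le_ceil _)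
        _ = (L ^ (δ / 2)) ^ ⌈2 / δ⌉₊ := Real.rpow_natCast _ _
        _ ≤ _ := by gcongr
    have h2 : (2 : ℝ) ≤ 2 ^ Nat.clog 2 q := by
      exact_mod_cast hq2.trans hqa
    have h3 : (b + 2 : ℝ) ≤ (2 ^ Nat.clog 2 q) ^ (⌈2 / δ⌉₊ + 2) := by
      calc (b + 2 : ℝ) ≤ L * 2 ^ 2 := by linarith
        _ ≤ _ := by
          rw [pow_add]
          gcongr
    exact_mod_cast h3
  · calc ((2 ^ Nat.clog 2 q) ^ 2 : ℝ) ≤ (4 * L ^ (δ / 2)) ^ 2 := by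
          gcongr
          calc (2 ^ Nat.clog 2 q : ℝ) ≤ 2 * q := by exact_mod_cast haq
            _ ≤ _ := by linarith
      _ = 16 * L ^ δ := by
          rw [mul_pow, ← Real.rpow_natCast (L ^ (δ / 2)), ← Real.rpow_mul hL0.le]
          norm_num
      _ ≤ 16 * L ^ ε := by
          gcongr
  · have h1 : 1 / δ ≤ max 1 (1 / ε) := by
      rcases min_choice ε 1 with h | h
      · rw [hδ, h]; exact le_max_right _ _
      · rw [hδ, h, div_one]; exact le_max_left _ _
    have h2 : (⌈2 / δ⌉₊ : ℝ) < 2 / δ + 1 := Nat.ceil_lt_add_one (by positivity)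
    have h3 : (1 : ℝ) ≤ max 1 (1 / ε) := le_max_left _ _
    have h4 : 2 / δ = 2 * (1 / δ) := by ring
    push_cast
    linarith

theorem mainTheorem4 (κ : ℕ) :
    ∃ (P : WordRAM.Prog) (c : ℕ) (C : ℝ),
      ∀ (ε : ℝ), 0 < ε →
      ∀ (r N : ℕ), 2 ≤ r → r ≤ N ^ κ →
      ∀ (G : Type*) [AddCommGroup G] (code : G ≃ Fin N)
        (p : Fin r → Fin r × Fin r) (v : Fin r → G),
      ∃ mem : List (BitVec (c * Nat.clog 2 N)),
        ((mem.length * (c * Nat.clog 2 N) : ℕ) : ℝ)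
            ≤ C * (max 1 (1 / ε) * r * Real.logb 2 N) ∧
        ∀ x₁ x₂ y₁ y₂ : Fin r,
          ∃ (s : WordRAM.Regs (c * Nat.clog 2 N)) (t : ℕ),
            WordRAM.Exec mem code P
              (WordRAM.initRegs (c * Nat.clog 2 N) x₁ x₂ y₁ y₂) s t ∧
            (s 0).toNat = (code (rectSum p v x₁ x₂ y₁ y₂) : ℕ) ∧
            (t : ℝ) ≤ C * (max 1 (1 / ε) * Real.logb 2 r ^ (2 + ε)) := by
  -- Since `Nat.log 2 r + 1 ≤ (κ + 1) * Nat.clog 2 N`, a word has the required `16 * (b + 1)` bits.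
  -- The constant covers 16000 for space and 6400000 for time.
  refine ⟨WordRAM.queryProg, 16 * (κ + 1), 10 ^ 7 * (κ + 1), fun ε hε r N hr hrN G _ code p v => ?_⟩
  have hN : 2 ≤ N := by
    by_contra h
    have : N ^ κ ≤ 1 ^ κ := Nat.pow_le_pow_left (by omega) κ
    rw [one_pow] at this
    omega
  have hr0 : r ≠ 0 := by omega
  have hclog : 0 < Nat.clog 2 N := Nat.clog_pos (by norm_num) hN
  have hNc : N ≤ 2 ^ Nat.clog 2 N := Nat.le_pow_clog (by norm_num) N
  have hbr : 2 ^ Nat.log 2 r ≤ r := Nat.pow_log_le_self 2 hr0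
  have hrb : r < 2 ^ (Nat.log 2 r + 1) := Nat.lt_pow_succ_log_self (by norm_num) r
  have hL : 1 ≤ Real.logb 2 r := by
    rw [Real.le_logb_iff_rpow_le (by norm_num) (by positivity), Real.rpow_one]
    exact_mod_cast hr
  have hLN : 1 ≤ Real.logb 2 N := by
    rw [Real.le_logb_iff_rpow_le (by norm_num) (by positivity), Real.rpow_one]
    exact_mod_cast hN
  have hbL : (Nat.log 2 r : ℝ) ≤ Real.logb 2 r := by
    rw [Real.le_logb_iff_rpow_le (by norm_num) (by positivity), Real.rpow_natCast]
    exact_mod_cast hbr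
  have hLb : Real.logb 2 r < Nat.log 2 r + 1 := by
    rw [Real.logb_lt_iff_lt_rpow (by norm_num) (by positivity), ← Nat.cast_add_one,
      Real.rpow_natCast]
    exact_mod_cast hrb
  have hcN : (Nat.clog 2 N : ℝ) ≤ 2 * Real.logb 2 N := by
    have h1 : (((Nat.clog 2 N).pred : ℕ) : ℝ) ≤ Real.logb 2 N := by
      rw [Real.le_logb_iff_rpow_le (by norm_num) (by positivity), Real.rpow_natCast]
      exact_mod_cast (Nat.pow_pred_clog_lt_self (b := 2) (by norm_num) hN).le
    have h2 : (Nat.clog 2 N : ℝ) = (Nat.clog 2 N).pred + 1 := by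
      rw [← Nat.cast_add_one, ← Nat.succ_eq_add_one, Nat.succ_pred hclog.ne']
    linarith
  have hbκ : Nat.log 2 r ≤ κ * Nat.clog 2 N := by
    rw [← Nat.pow_le_pow_iff_right (a := 2) (by norm_num), mul_comm, pow_mul]
    exact hbr.trans (hrN.trans (Nat.pow_le_pow_left hNc κ))
  obtain ⟨a, K, ha, hK, hab, haQ, hbK, haL, hKε⟩ := exists_branching hL hε hbL hLb
  obtain ⟨mem, hmem⟩ := exists_memory (w := 16 * (κ + 1) * Nat.clog 2 N) code p v hr ha hab haQ hrb
    (by rw [pow_succ]; omega) (by nlinarith)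
    (hNc.trans (Nat.pow_le_pow_right (by norm_num) (by nlinarith)))
  obtain ⟨hlen, hquery⟩ := hmem K hK hbK
  generalize max 1 (1 / ε) = m at *
  have hm : 0 ≤ m := by
    have : (0 : ℝ) ≤ K := K.cast_nonneg
    linarith
  have hL0 : 0 < Real.logb 2 r := one_pos.trans_le hL
  refine ⟨mem, ?_, fun x₁ x₂ y₁ y₂ => ?_⟩
  · have hlen' : (mem.length : ℝ) ≤ 100 * K * r := by exact_mod_cast hlen
    push_cast
    calc (mem.length : ℝ) * (16 * (κ + 1) * Nat.clog 2 N)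
        ≤ 100 * (5 * m) * r * (16 * (κ + 1) * (2 * Real.logb 2 N)) := by
          gcongr
          exact hlen'.trans (by gcongr)
      _ = 16000 * (κ + 1) * (m * r * Real.logb 2 N) := by ring
      _ ≤ _ := by
          gcongr
          norm_num
  · obtain ⟨s, t, h1, h2, h3⟩ := hquery x₁ x₂ y₁ y₂
    refine ⟨s, t, h1, h2, ?_⟩
    have h3' : (t : ℝ) ≤ 20000 * (2 ^ a) ^ 2 * K * (Nat.log 2 r + 1) ^ 2 := by exact_mod_cast h3
    calc (t : ℝ) ≤ 20000 * (16 * Real.logb 2 r ^ ε) * (5 * m) * (2 * Real.logb 2 r) ^ 2 := by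
          refine h3'.trans ?_
          gcongr
          linarith
      _ = 6400000 * (m * Real.logb 2 r ^ (2 + ε)) := by
          rw [Real.rpow_add hL0, Real.rpow_two]
          ring
      _ ≤ _ := by
          gcongr
          have : (0 : ℝ) ≤ κ := κ.cast_nonneg
          linarith
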